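/- Let $q \geq 3$ be a prime power and let $k \geq 5$ be an integer. For integers $0 \leq m \leq n$ let $\left[{n \atop m}\right]_q$ denote the number of $m$-dimensional subspaces of $\mathbb{F}_q^n$. Let $Y$ be an intersecting family of $k$-dimensional subspaces of $\mathbb{F}_q^{2k}$, that is, a set of $k$-dimensional subspaces any two of which intersect non-trivially (equivalently, an independent set of the $q$-Kneser graph $qK_{2k:k}$, whose vertices are the $k$-dimensional subspaces of $\mathbb{F}_q^{2k}$, two being adjacent if they intersect trivially). Suppose that $Y$ is contained neither in a dictator (the set of all $k$-dimensional subspaces containing a fixed $1$-dimensional subspace) nor in the dual of a dictator (the set of all $k$-dimensional subspaces contained in a fixed hyperplane, i.e. in a fixed $(2k-1)$-dimensional subspace). Then \[ |Y| < \left(1 + 3q^{-1}\right) \left[{k \atop 1}\right]_q \left[{2k-2 \atop k-2}\right]_q . \] -/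

import Mathlib

/-- The `k`-spaces of `F ^ n`: linear subspaces of (vector space) dimension `k`. -/
abbrev KSpace (F : Type*) [Field F] (n k : ℕ) : Type _ :=
  {W : Submodule F (Fin n → F) // Module.finrank F W = k}

/-- The Gaussian coefficient: the number of `k`-spaces in `F ^ n`, for a finite field `F`. -/
noncomputable def gaussCoeff (F : Type*) [Field F] (n k : ℕ) : ℕ :=
  Nat.card (KSpace F n k)

/-- The `q`-Kneser graph: the vertices are the `k`-spaces of `F ^ n`, and two distinct vertices
are adjacent if they intersect trivially (distinctness is automatic for `k ≥ 1`). -/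
def qKneser (F : Type*) [Field F] (n k : ℕ) : SimpleGraph (KSpace F n k) where
  Adj U W := U ≠ W ∧ U.1 ⊓ W.1 = ⊥
  symm := ⟨fun _ _ h => ⟨h.1.symm, inf_comm (α := Submodule F (Fin n → F)) _ _ ▸ h.2⟩⟩
  loopless := ⟨fun _ h => h.1 rfl⟩

/-- A dictator: the set of all `k`-spaces containing a fixed point (a `1`-space) `P`. -/
def IsDictator {F : Type*} [Field F] {n k : ℕ} (D : Set (KSpace F n k)) : Prop :=
  ∃ P : Submodule F (Fin n → F), Module.finrank F P = 1 ∧ D = {W | P ≤ W.1}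

/-- The dual of a dictator: the set of all `k`-spaces contained in a fixed hyperplane
(an `(n - 1)`-space) `H`. -/
def IsDualDictator {F : Type*} [Field F] {n k : ℕ} (D : Set (KSpace F n k)) : Prop :=
  ∃ H : Submodule F (Fin n → F), Module.finrank F H + 1 = n ∧ D = {W | W.1 ≤ H}

/-! Write Q = q^k, P = q^(k-1) - 1, n = q^(k^2), and suppose that Y reaches the bound. Split F^(2k)
as F^k × F^k. The graphs of the k × k matrices form a chart of n vertices, in which two graphs that
meet non-trivially have a singular difference. Averaging over all linear automorphisms
(`exists_linearEquiv_average`) moves the chart so that it catches at least the expected share of Y.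
This yields a set A of a matrices with pairwise singular differences and a (Q - 1) ≥ n (q + 5/2) /
(q (q - 1)). Three facts about A are contradictory.

Small degrees. As Y lies in no dictator or dual dictator, few members share a point or a hyperplane
(`ncard_point_le`, `ncard_hyperplane_le`), so for u ≠ 0 a condition X u = x or u X = x holds on at
most a share 3q / (3q + 1) of A. If it holds for d members, a cross-independence form of the ratio
bound (`card_mul_card_le`) gives d (a - d) ≤ n^2 / (Q^2 P). Hence d is tiny: at most D, of order n^2
/ (Q^2 P a).

Large rank-one weight. The Fourier coefficients of the indicator of GL, divided by |GL|, depend only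
on the rank of the frequency (`glHat_eq`). They are 1 at rank 0, -1 / (Q - 1) at rank 1, and at most
1 / ((Q - 1) P) in absolute value beyond. Singular differences make the weighted Fourier energy of A
vanish, so the rank-one energy W must nearly balance the term a^2 of the zero frequency
(`rankOneWeight_ge`).

Level-one inequality. Let f be n times the projection of the indicator of A to the rank-one
frequencies, a sum of line parts indexed by pairs of projective points (p, r). Then W is the sum of
f over A (`rankOneWeight_eq`). A product of three line parts sums to zero unless all three share p
or all three share r (`sum_linePart_mul_mul`), so ∑ f^3 ≤ 2 Q D ∑ f^2 (`sum_levelOne_pow_three_le`).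
Since f ≥ -s for s = a (Q - 1) / (q - 1), convexity of t^2 (t + s) gives Δ (Δ + s) ≤ n (2 Q D + s)
for the average Δ = W / a (`levelOne_average_le`). With D tiny and W large this is false
(`level_inequality_false`). -/

namespace QKneser

open Matrix Finset
open scoped LinearAlgebra.Projectivization

set_option linter.unusedSectionVars false

/-! ### Additive characters on matrices and the Fourier transform of GL -/

section Fourier

variable {F : Type*} [Field F] [Fintype F]

/-- A fixed primitive additive character of the finite field `F`. -/
noncomputable def baseChar (F : Type*) [Field F] [Fintype F] : AddChar F ℂ :=
  AddChar.FiniteField.primitiveChar_to_Complex F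

theorem baseChar_ne_zero : baseChar F ≠ 0 := by
  have h := AddChar.FiniteField.primitiveChar_to_Complex_isPrimitive F (a := 1) one_ne_zero
  intro h0
  apply h
  rw [AddChar.mulShift_one]
  exact h0

theorem sum_baseChar_linear {E : Type*} [AddCommGroup E] [Module F E] [Fintype E]
    (φ : E →ₗ[F] F) [Decidable (φ = 0)] :
    ∑ x, baseChar F (φ x) = if φ = 0 then (Fintype.card E : ℂ) else 0 := by
  classical
  split_ifs with h
  · simp [h]
  · have key := (AddChar.sum_eq_zero_iff_ne_zero
      (ψ := (baseChar F).compAddMonoidHom φ.toAddMonoidHom)).2 ?_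
    · simpa using key
    · obtain ⟨t, ht⟩ := (AddChar.ne_one_iff (ψ := baseChar F)).1 baseChar_ne_zero
      obtain ⟨x, hx⟩ : ∃ x, φ x ≠ 0 := by
        by_contra! hc
        exact h (LinearMap.ext hc)
      intro h0
      apply ht
      have := DFunLike.congr_fun h0 ((t / φ x) • x)
      simpa [hx] using this

variable {k : ℕ}

/-- The trace pairing `⟨R, X⟩ = tr (Rᵀ X)`, as a linear form in `X`. -/
noncomputable def tracePairing (R : Matrix (Fin k) (Fin k) F) :
    Matrix (Fin k) (Fin k) F →ₗ[F] F :=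
  (Matrix.traceLinearMap (Fin k) F F).comp (LinearMap.mulLeft F Rᵀ)

theorem tracePairing_apply (R X : Matrix (Fin k) (Fin k) F) :
    tracePairing R X = (Rᵀ * X).trace := rfl

theorem tracePairing_comm (R X : Matrix (Fin k) (Fin k) F) :
    tracePairing R X = tracePairing X R := by
  rw [tracePairing_apply, tracePairing_apply, ← Matrix.trace_transpose, Matrix.transpose_mul,
    Matrix.transpose_transpose]

theorem tracePairing_mul (a R b X : Matrix (Fin k) (Fin k) F) :
    tracePairing (a * R * b) X = tracePairing R (aᵀ * X * bᵀ) := by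
  simp only [tracePairing_apply, Matrix.transpose_mul]
  rw [Matrix.mul_assoc, Matrix.trace_mul_comm]
  simp only [Matrix.mul_assoc]

theorem tracePairing_eq_sum (R X : Matrix (Fin k) (Fin k) F) :
    tracePairing R X = ∑ j, ∑ i, R i j * X i j := by
  simp [tracePairing_apply, Matrix.trace, Matrix.mul_apply]

theorem tracePairing_eq_zero_iff (R : Matrix (Fin k) (Fin k) F) :
    tracePairing R = 0 ↔ R = 0 := by
  constructor
  · intro h
    ext i j
    have := LinearMap.congr_fun h (Matrix.single i j 1)
    rw [tracePairing_apply] at this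
    simpa [Matrix.trace_mul_single] using this
  · rintro rfl
    ext X
    simp [tracePairing_apply]

theorem tracePairing_vecMulVec (v u : Fin k → F) (X : Matrix (Fin k) (Fin k) F) :
    tracePairing (vecMulVec v u) X = v ⬝ᵥ (X *ᵥ u) := by
  rw [tracePairing_apply, Matrix.transpose_vecMulVec, Matrix.vecMulVec_mul, Matrix.trace_vecMulVec,
    dotProduct_comm, Matrix.dotProduct_mulVec]

/-- The additive character of the matrix algebra attached to the frequency `R`. -/
noncomputable def matChar (R X : Matrix (Fin k) (Fin k) F) : ℂ := baseChar F (tracePairing R X)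

theorem matChar_comm (R X : Matrix (Fin k) (Fin k) F) : matChar R X = matChar X R := by
  rw [matChar, matChar, tracePairing_comm]

theorem matChar_add (R X Y : Matrix (Fin k) (Fin k) F) :
    matChar R (X + Y) = matChar R X * matChar R Y := by
  simp [matChar, AddChar.map_add_eq_mul]

theorem matChar_neg (R X : Matrix (Fin k) (Fin k) F) :
    matChar R (-X) = starRingEnd ℂ (matChar R X) := by
  simp [matChar, AddChar.map_neg_eq_conj]

theorem matChar_sub (R X Y : Matrix (Fin k) (Fin k) F) :
    matChar R (X - Y) = matChar R X * starRingEnd ℂ (matChar R Y) := by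
  rw [sub_eq_add_neg, matChar_add, matChar_neg]

@[simp] theorem matChar_zero_left (X : Matrix (Fin k) (Fin k) F) : matChar 0 X = 1 := by
  simp [matChar, tracePairing_apply]

@[simp] theorem matChar_zero_right (X : Matrix (Fin k) (Fin k) F) : matChar X 0 = 1 := by
  simp [matChar]

theorem card_matrix_sq : Fintype.card (Matrix (Fin k) (Fin k) F) = Fintype.card F ^ (k ^ 2) := by
  rw [sq, pow_mul]
  change Fintype.card (Fin k → Fin k → F) = _
  rw [Fintype.card_fun, Fintype.card_fun, Fintype.card_fin]

theorem sum_matChar (R : Matrix (Fin k) (Fin k) F) [Decidable (R = 0)] :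
    ∑ X, matChar R X = if R = 0 then (Fintype.card F : ℂ) ^ (k ^ 2) else 0 := by
  classical
  simp only [matChar]
  rw [sum_baseChar_linear]
  simp only [tracePairing_eq_zero_iff, card_matrix_sq]
  push_cast
  rfl

theorem sum_matChar_left (X : Matrix (Fin k) (Fin k) F) [Decidable (X = 0)] :
    ∑ R, matChar R X = if X = 0 then (Fintype.card F : ℂ) ^ (k ^ 2) else 0 := by
  simp_rw [fun R => matChar_comm R X]
  exact sum_matChar X

variable [DecidableEq F]

/-- The Fourier transform of the indicator function of the general linear group. -/
noncomputable def glHat (R : Matrix (Fin k) (Fin k) F) : ℂ :=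
  ∑ g : GL (Fin k) F, matChar R g.val

theorem glHat_mul (a b : GL (Fin k) F) (R : Matrix (Fin k) (Fin k) F) :
    glHat (a.val * R * b.val) = glHat R := by
  let at' : GL (Fin k) F := GeneralLinearGroup.mkOfDetNeZero a.valᵀ
    (by rw [Matrix.det_transpose]; exact a.det_ne_zero)
  let bt : GL (Fin k) F := GeneralLinearGroup.mkOfDetNeZero b.valᵀ
    (by rw [Matrix.det_transpose]; exact b.det_ne_zero)
  unfold glHat
  refine Fintype.sum_equiv ((Equiv.mulLeft at').trans (Equiv.mulRight bt)) _ _ ?_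
  intro g
  simp only [matChar, tracePairing_mul]
  rfl

/-- Conjugation by a permutation preserves GL and the trace pairing. This absorbs the arbitrary
indexing in the rank normal form. -/
theorem glHat_submatrix (σ : Fin k ≃ Fin k) (R : Matrix (Fin k) (Fin k) F) :
    glHat (R.submatrix σ σ) = glHat R := by
  unfold glHat
  refine Fintype.sum_equiv
    (Units.mapEquiv (Matrix.reindexAlgEquiv F F σ).toMulEquiv).toEquiv _ _ ?_
  intro g
  simp only [matChar]
  congr 1
  simp only [tracePairing_eq_sum]
  rw [← Equiv.sum_comp σ (fun j => ∑ i, R i j * _)]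
  refine Finset.sum_congr rfl fun j _ => ?_
  rw [← Equiv.sum_comp σ (fun i => R i (σ j) * _)]
  simp

/-- Multiplication by invertible matrices on both sides leaves `glHat` unchanged and brings any
matrix to a normal form that depends only on its rank. -/
theorem glHat_eq_of_rank_eq {R S : Matrix (Fin k) (Fin k) F} (h : R.rank = S.rank) :
    glHat R = glHat S := by
  have key : ∀ (r : ℕ) (R : Matrix (Fin k) (Fin k) F), R.rank = r →
      ∃ (e : Fin k ≃ Fin r ⊕ Fin (k - r)),
        glHat R = glHat ((fromBlocks (1 : Matrix (Fin r) (Fin r) F) 0 0 0).submatrix e e) := by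
    rintro r R rfl
    obtain ⟨V, U, e, hV, hU, hN⟩ := Matrix.exists_rank_normal_form R
    have hc : Fintype.card (Fin k) - R.rank = k - R.rank := by rw [Fintype.card_fin]
    refine ⟨e.trans (Equiv.sumCongr (Equiv.refl _) (finCongr hc)), ?_⟩
    obtain ⟨V, rfl⟩ := hV
    obtain ⟨U, rfl⟩ := hU
    rw [← glHat_mul V U R, hN]
    congr 1
    ext i j
    simp only [submatrix_apply, Equiv.trans_apply]
    rcases e i with a | a <;> rcases e j with b | b <;> simp
  obtain ⟨e, he⟩ := key _ R h
  obtain ⟨e', he'⟩ := key _ S rfl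
  rw [he, he', ← glHat_submatrix (e'.trans e.symm)]
  congr 1
  ext i j
  simp

/-- The linear span of the columns of `R` other than the column `j`. -/
def colSpan (R : Matrix (Fin k) (Fin k) F) (j : Fin k) : Submodule F (Fin k → F) :=
  Submodule.span F (R.col '' {j}ᶜ)

theorem rank_updateCol (R : Matrix (Fin k) (Fin k) F) (j : Fin k) (v : Fin k → F)
    [Decidable (v ∈ colSpan R j)] :
    (R.updateCol j v).rank = Module.finrank F (colSpan R j) + if v ∈ colSpan R j then 0 else 1 := by
  have hspan : Submodule.span F (Set.range (R.updateCol j v).col) =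
      Submodule.span F {v} ⊔ colSpan R j := by
    rw [colSpan, ← Submodule.span_union]
    congr 1
    ext w
    simp only [Set.mem_range, Set.singleton_union, Set.mem_insert_iff, Set.mem_image,
      Set.mem_compl_iff, Set.mem_singleton_iff]
    constructor
    · rintro ⟨i, rfl⟩
      by_cases hi : i = j
      · left; subst hi; ext a; simp [Matrix.col]
      · right; exact ⟨i, hi, by ext a; simp [Matrix.col, hi]⟩
    · rintro (rfl | ⟨i, hi, rfl⟩)
      · exact ⟨j, by ext a; simp [Matrix.col]⟩
      · exact ⟨i, by ext a; simp [Matrix.col, hi]⟩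
  rw [Matrix.rank_eq_finrank_span_cols, hspan]
  split_ifs with hv
  · rw [sup_eq_right.2 ((Submodule.span_singleton_le_iff_mem _ _).2 hv), add_zero]
  · have h0 : v ≠ 0 := fun h => hv (h ▸ zero_mem _)
    have hinf : Submodule.span F {v} ⊓ colSpan R j = ⊥ := by
      rw [eq_bot_iff]
      rintro w ⟨hw1, hw2⟩
      obtain ⟨t, rfl⟩ := Submodule.mem_span_singleton.1 hw1
      by_cases ht : t = 0
      · simp [ht]
      · exact absurd (by simpa [smul_smul, ht] using (colSpan R j).smul_mem t⁻¹ hw2) hv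
    have := Submodule.finrank_sup_add_finrank_inf_eq (Submodule.span F {v}) (colSpan R j)
    rw [hinf, finrank_bot, finrank_span_singleton h0] at this
    omega

theorem finrank_colSpan_lt (R : Matrix (Fin k) (Fin k) F) (j : Fin k) :
    Module.finrank F (colSpan R j) < k := by
  classical
  have h1 : Module.finrank F (colSpan R j) ≤ (({j}ᶜ : Finset (Fin k)).image R.col).card := by
    have := finrank_span_finset_le_card (R := F) (({j}ᶜ : Finset (Fin k)).image R.col)
    rw [Finset.coe_image, Finset.coe_compl, Finset.coe_singleton] at this
    exact this
  have h2 := Finset.card_image_le (s := ({j}ᶜ : Finset (Fin k))) (f := R.col)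
  rw [Finset.card_compl, Fintype.card_fin, Finset.card_singleton] at h2
  have := j.pos
  omega

theorem matChar_updateCol (R X : Matrix (Fin k) (Fin k) F) (j : Fin k) (v : Fin k → F) :
    matChar (R.updateCol j v) X = matChar (R.updateCol j 0) X * baseChar F (v ⬝ᵥ X.col j) := by
  rw [matChar, matChar, ← AddChar.map_add_eq_mul]
  congr 1
  simp only [tracePairing_eq_sum]
  rw [← Finset.add_sum_erase _ _ (Finset.mem_univ j), ← Finset.add_sum_erase
    _ (fun x => ∑ i, R.updateCol j 0 i x * X i x) (Finset.mem_univ j)]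
  have : ∑ x ∈ univ.erase j, ∑ i, R.updateCol j v i x * X i x =
      ∑ x ∈ univ.erase j, ∑ i, R.updateCol j 0 i x * X i x := by
    refine Finset.sum_congr rfl fun x hx => ?_
    have := Finset.ne_of_mem_erase hx
    simp [this]
  rw [this]
  simp [dotProduct, Matrix.col, add_comm]

theorem sum_baseChar_dotProduct (w : Fin k → F) [Decidable (w = 0)] :
    ∑ v : Fin k → F, baseChar F (v ⬝ᵥ w) = if w = 0 then (Fintype.card F : ℂ) ^ k else 0 := by
  classical
  have := sum_baseChar_linear (F := F) (dotProductBilin F F w)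
  simp only [dotProductBilin_apply_apply] at this
  rw [Finset.sum_congr rfl fun v _ => by rw [dotProduct_comm v w], this]
  have hiff : dotProductBilin F F w = 0 ↔ w = 0 := by
    constructor
    · intro h
      ext i
      simpa using LinearMap.congr_fun h (Pi.single i 1)
    · rintro rfl
      exact map_zero _
  simp only [hiff, Fintype.card_fun, Fintype.card_fin, Nat.cast_pow]

/-- Summing the character over all choices of column j detects the matrices g whose j-th column is
zero, and no invertible g has one. This relation between consecutive ranks determines `glHat`. -/
theorem sum_glHat_updateCol (R : Matrix (Fin k) (Fin k) F) (j : Fin k) :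
    ∑ v, glHat (R.updateCol j v) = 0 := by
  unfold glHat
  rw [Finset.sum_comm]
  refine Finset.sum_eq_zero fun g _ => ?_
  rw [Finset.sum_congr rfl fun v _ => matChar_updateCol R g.val j v, ← Finset.mul_sum,
    sum_baseChar_dotProduct, if_neg, mul_zero]
  intro h
  apply g.det_ne_zero
  exact Matrix.det_eq_zero_of_column_eq_zero j (fun i => congrFun h i)

end Fourier

/-! ### The Fourier coefficients of GL as a function of rank, and their sizes -/

section RankEigenvalue

/-- The normalised Fourier coefficients of the general linear group as a function of the rank. -/
noncomputable def rankEigenvalue (q : ℝ) (k : ℕ) : ℕ → ℝ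
  | 0 => 1
  | r + 1 => -rankEigenvalue q k r / (q ^ (k - r) - 1)

theorem rankEigenvalue_one (q : ℝ) (k : ℕ) : rankEigenvalue q k 1 = -1 / (q ^ k - 1) := by
  simp [rankEigenvalue]

section bounds

variable {q : ℝ} {k : ℕ}

theorem one_le_pow_sub_one (hq : 2 ≤ q) {m : ℕ} (hm : m ≠ 0) : 1 ≤ q ^ m - 1 := by
  have := pow_le_pow_right₀ (by linarith : (1 : ℝ) ≤ q) (Nat.one_le_iff_ne_zero.2 hm)
  rw [pow_one] at this
  linarith

/-- Each step of the recursion divides by a number of absolute value at least 1, so the value at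
rank 2 dominates the later ones. -/
theorem abs_rankEigenvalue_le (hq : 2 ≤ q) {r : ℕ} (hr : 2 ≤ r) (hrk : r ≤ k) :
    |rankEigenvalue q k r| ≤ 1 / ((q ^ k - 1) * (q ^ (k - 1) - 1)) := by
  induction r, hr using Nat.le_induction with
  | base =>
    have h1 := one_le_pow_sub_one hq (m := k) (by omega)
    have h2 := one_le_pow_sub_one hq (m := k - 1) (by omega)
    have h : rankEigenvalue q k 2 = 1 / ((q ^ k - 1) * (q ^ (k - 1) - 1)) := by
      have h1' : q ^ k - 1 ≠ 0 := by linarith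
      have h2' : q ^ (k - 1) - 1 ≠ 0 := by linarith
      simp only [rankEigenvalue, Nat.sub_zero]
      field_simp
    rw [h, abs_of_nonneg]
    positivity
  | succ r hr ih =>
    have h1 := one_le_pow_sub_one hq (m := k - r) (by omega)
    simp only [rankEigenvalue]
    rw [abs_div, abs_neg, abs_of_nonneg (by linarith : (0 : ℝ) ≤ q ^ (k - r) - 1)]
    exact (div_le_self (abs_nonneg _) h1).trans (ih (by omega))

/-- Let only one column of a matrix vary, the others spanning dimension d. Then q^d choices give
rank d and the remaining q^k - q^d give rank d + 1, so this is the sum of the squared eigenvalues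
over such a coset. -/
theorem rankEigenvalue_sq_coset (hq : 2 ≤ q) {d : ℕ} (hd : d < k) :
    q ^ d * rankEigenvalue q k d ^ 2 + (q ^ k - q ^ d) * rankEigenvalue q k (d + 1) ^ 2 =
      q ^ k * (rankEigenvalue q k d ^ 2 / (q ^ (k - d) - 1)) := by
  have h1 := one_le_pow_sub_one hq (m := k - d) (by omega)
  have h1' : q ^ (k - d) - 1 ≠ 0 := by linarith
  have h2 : q ^ k = q ^ d * q ^ (k - d) := by rw [← pow_add]; congr 1; omega
  simp only [rankEigenvalue]
  rw [h2]
  field_simp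
  ring

/-- The coset average does not increase with d, so d = 1 is the worst case. Excluding d = 0 is what
gains the extra factor q^(k-1) - 1. -/
theorem rankEigenvalue_sq_div_le (hq : 2 ≤ q) {d : ℕ} (hd : 1 ≤ d) (hdk : d < k) :
    rankEigenvalue q k d ^ 2 / (q ^ (k - d) - 1) ≤
      1 / ((q ^ k - 1) ^ 2 * (q ^ (k - 1) - 1)) := by
  induction d, hd using Nat.le_induction with
  | base =>
    rw [rankEigenvalue_one, div_pow, div_div]
    simp
  | succ d hd ih =>
    refine le_trans ?_ (ih (by omega))
    have h1 := one_le_pow_sub_one hq (m := k - d) (by omega)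
    have h2 := one_le_pow_sub_one hq (m := k - (d + 1)) (by omega)
    simp only [rankEigenvalue]
    rw [div_pow, neg_sq, div_div]
    refine div_le_div_of_nonneg_left (sq_nonneg _) (by linarith) ?_
    nlinarith

theorem rankEigenvalue_sq_coset_le (hq : 2 ≤ q) {d : ℕ} (hd : 1 ≤ d) (hdk : d < k) :
    q ^ d * rankEigenvalue q k d ^ 2 + (q ^ k - q ^ d) * rankEigenvalue q k (d + 1) ^ 2 ≤
      q ^ k / ((q ^ k - 1) ^ 2 * (q ^ (k - 1) - 1)) := by
  rw [rankEigenvalue_sq_coset hq hdk, div_eq_mul_one_div (q ^ k)]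
  exact mul_le_mul_of_nonneg_left (rankEigenvalue_sq_div_le hq hd hdk) (by positivity)

end bounds

variable {F : Type*} [Field F] [Fintype F] [DecidableEq F] {k : ℕ}

theorem two_le_card : (2 : ℝ) ≤ Fintype.card F := by
  exact_mod_cast Fintype.one_lt_card

theorem sum_rank_updateCol {E : Type*} [NormedField E] (φ : ℕ → E) (R : Matrix (Fin k) (Fin k) F)
    (j : Fin k) :
    ∑ v, φ (R.updateCol j v).rank =
      (Fintype.card F : E) ^ Module.finrank F (colSpan R j) * φ (Module.finrank F (colSpan R j)) +
      ((Fintype.card F : E) ^ k - (Fintype.card F : E) ^ Module.finrank F (colSpan R j)) *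
        φ (Module.finrank F (colSpan R j) + 1) := by
  classical
  set d := Module.finrank F (colSpan R j)
  have hC : (univ.filter (fun v => v ∈ colSpan R j)).card = Fintype.card F ^ d := by
    rw [← Module.card_eq_pow_finrank (K := F) (V := colSpan R j), Fintype.card_subtype]
  have hall : (univ : Finset (Fin k → F)).card = Fintype.card F ^ k := by
    simp
  have hC' := Finset.card_filter_add_card_filter_not (s := (univ : Finset (Fin k → F)))
    (fun v => v ∈ colSpan R j)
  rw [hC, hall] at hC'
  simp_rw [rank_updateCol]
  rw [← Finset.sum_filter_add_sum_filter_not _ (fun v => v ∈ colSpan R j)]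
  rw [Finset.sum_congr rfl (g := fun _ => φ d), Finset.sum_congr rfl (g := fun _ => φ (d + 1))
    (s₁ := filter (fun v => v ∉ colSpan R j) univ)]
  · simp only [Finset.sum_const, nsmul_eq_mul, hC]
    have hC2 : ((univ.filter (fun v => v ∉ colSpan R j)).card : E) =
        (Fintype.card F : E) ^ k - (Fintype.card F : E) ^ d := by
      rw [eq_sub_iff_add_eq, add_comm]
      have := congrArg (Nat.cast (R := E)) hC'
      push_cast at this
      exact this
    rw [hC2]
    push_cast
    rfl
  · intro v hv
    simp [(Finset.mem_filter.1 hv).2, d]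
  · intro v hv
    simp [(Finset.mem_filter.1 hv).2, d]

theorem rank_diagonal_lt (r : ℕ) (hr : r ≤ k) :
    (diagonal (fun i : Fin k => if (i : ℕ) < r then (1 : F) else 0)).rank = r := by
  rw [Matrix.rank_diagonal]
  simp only [ne_eq, ite_eq_right_iff, one_ne_zero, imp_false, not_not]
  rw [Fintype.card_subtype, Fin.card_filter_val_lt, min_eq_right hr]

/-- Induction on the rank. Over a coset whose fixed columns span dimension r, the vanishing sum
reads q^r φ(r) + (q^k - q^r) φ(r + 1) = 0, which is the recursion defining `rankEigenvalue`. -/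
theorem glHat_eq (R : Matrix (Fin k) (Fin k) F) :
    glHat R = Fintype.card (GL (Fin k) F) * (rankEigenvalue (Fintype.card F) k R.rank : ℂ) := by
  obtain ⟨r, hr⟩ : ∃ r, R.rank = r := ⟨_, rfl⟩
  rw [hr]
  induction r generalizing R with
  | zero =>
    rw [glHat_eq_of_rank_eq (S := 0) (by rw [hr, Matrix.rank_zero])]
    simp [glHat, rankEigenvalue]
  | succ r ih =>
    have hrk : r < k := by
      have := Matrix.rank_le_width R
      omega
    set D : Matrix (Fin k) (Fin k) F := diagonal (fun i => if (i : ℕ) < r then (1 : F) else 0)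
    set j : Fin k := ⟨r, hrk⟩
    -- Column r of D is already zero, so the other columns span exactly r dimensions.
    have hD : D.updateCol j 0 = D := by
      ext a b
      by_cases hb : b = j
      · subst hb
        simp only [updateCol_self, Pi.zero_apply, D]
        by_cases hab : a = j
        · subst hab; simp [j]
        · simp [hab]
      · simp [hb]
    have hd : Module.finrank F (colSpan D j) = r := by
      classical
      have := rank_updateCol D j 0
      rw [hD, rank_diagonal_lt r hrk.le] at this
      simpa using this.symm
    have hsum := sum_glHat_updateCol D j
    have hsum2 : ∑ v, (fun m => if m = r then (Fintype.card (GL (Fin k) F) *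
          (rankEigenvalue (Fintype.card F) k r : ℂ)) else glHat R) (D.updateCol j v).rank = 0 := by
      classical
      rw [← hsum]
      refine Finset.sum_congr rfl fun v _ => ?_
      have h1 := rank_updateCol D j v
      rw [hd] at h1
      simp only
      split_ifs with h2
      · exact (ih _ h2).symm
      · refine glHat_eq_of_rank_eq ?_
        rw [hr, h1]
        split_ifs with h3
        · exact absurd (by rw [h1, if_pos h3, add_zero]) h2
        · rfl
    rw [sum_rank_updateCol (fun m => if m = r then (Fintype.card (GL (Fin k) F) *
          (rankEigenvalue (Fintype.card F) k r : ℂ)) else glHat R), hd] at hsum2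
    simp only [if_true, Nat.succ_ne_self, if_false] at hsum2
    have hq := two_le_card (F := F)
    have h1 := one_le_pow_sub_one hq (m := k - r) (by omega)
    have hne : ((Fintype.card F : ℂ)) ^ (k - r) - 1 ≠ 0 := by
      have : ((Fintype.card F : ℝ)) ^ (k - r) - 1 ≠ 0 := by linarith
      exact_mod_cast this
    have hqne : (Fintype.card F : ℂ) ≠ 0 := by
      have : (Fintype.card F : ℝ) ≠ 0 := by linarith
      exact_mod_cast this
    have hk : (Fintype.card F : ℂ) ^ k =
        (Fintype.card F : ℂ) ^ r * (Fintype.card F : ℂ) ^ (k - r) := by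
      rw [← pow_add]; congr 1; omega
    rw [hk] at hsum2
    have hfac : (Fintype.card F : ℂ) ^ r * ((Fintype.card (GL (Fin k) F) *
          (rankEigenvalue (Fintype.card F) k r : ℂ)) +
          ((Fintype.card F : ℂ) ^ (k - r) - 1) * glHat R) = 0 := by
      rw [← hsum2]; ring
    have h3 := (mul_eq_zero.1 hfac).resolve_left (pow_ne_zero _ hqne)
    simp only [rankEigenvalue]
    push_cast
    rw [← mul_div_assoc, eq_div_iff hne]
    linear_combination h3

end RankEigenvalue

/-! ### Fourier transforms of sets of matrices and the stability form of the ratio bound -/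

section SetTransform

variable {F : Type*} [Field F] [Fintype F] [DecidableEq F] {k : ℕ}

/-- The Fourier transform of the indicator function of a set of matrices. -/
noncomputable def setHat (A : Finset (Matrix (Fin k) (Fin k) F)) (R : Matrix (Fin k) (Fin k) F) :
    ℂ :=
  ∑ X ∈ A, matChar R X

@[simp] theorem setHat_zero (A : Finset (Matrix (Fin k) (Fin k) F)) : setHat A 0 = A.card := by
  simp [setHat]

/-- Orthogonality of characters counts the pairs with X - Y = -Z. The case Z = 0, A = B is Parseval;
for invertible Z the count is zero when all differences are singular. -/
theorem sum_setHat_mul_conj (A B : Finset (Matrix (Fin k) (Fin k) F))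
    (Z : Matrix (Fin k) (Fin k) F) :
    ∑ R, matChar R Z * (setHat A R * starRingEnd ℂ (setHat B R)) =
      (Fintype.card F : ℂ) ^ (k ^ 2) * ∑ X ∈ A, ∑ Y ∈ B, if Z + (X - Y) = 0 then 1 else 0 := by
  have h : ∀ R, matChar R Z * (setHat A R * starRingEnd ℂ (setHat B R)) =
      ∑ X ∈ A, ∑ Y ∈ B, matChar R (Z + (X - Y)) := by
    intro R
    rw [setHat, setHat, map_sum, Finset.sum_mul_sum, Finset.mul_sum]
    refine Finset.sum_congr rfl fun X _ => ?_
    rw [Finset.mul_sum]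
    refine Finset.sum_congr rfl fun Y _ => ?_
    rw [matChar_add, matChar_sub]
  simp_rw [h]
  rw [Finset.sum_comm, Finset.mul_sum]
  refine Finset.sum_congr rfl fun X _ => ?_
  rw [Finset.sum_comm, Finset.mul_sum]
  refine Finset.sum_congr rfl fun Y _ => ?_
  rw [sum_matChar_left]
  simp

theorem sum_normSq_setHat (A : Finset (Matrix (Fin k) (Fin k) F)) :
    ∑ R, Complex.normSq (setHat A R) = (Fintype.card F : ℝ) ^ (k ^ 2) * A.card := by
  have h := sum_setHat_mul_conj A A 0
  simp only [matChar_zero_right, one_mul, zero_add, sub_eq_zero, Complex.mul_conj,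
    Finset.sum_ite_eq, Finset.sum_ite_mem, Finset.inter_self, Finset.sum_const, nsmul_eq_mul,
    mul_one] at h
  exact_mod_cast h

theorem sum_rankEigenvalue_setHat (A B : Finset (Matrix (Fin k) (Fin k) F))
    (h : ∀ X ∈ A, ∀ Y ∈ B, (X - Y).det = 0) :
    ∑ R, (rankEigenvalue (Fintype.card F) k R.rank : ℂ) *
      (setHat A R * starRingEnd ℂ (setHat B R)) = 0 := by
  have h0 : ∑ R, glHat R * (setHat A R * starRingEnd ℂ (setHat B R)) = 0 := by
    simp_rw [glHat, Finset.sum_mul]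
    rw [Finset.sum_comm]
    refine Finset.sum_eq_zero fun g _ => ?_
    rw [sum_setHat_mul_conj, Finset.sum_eq_zero, mul_zero]
    intro X hX
    refine Finset.sum_eq_zero fun Y hY => ?_
    rw [if_neg]
    intro hg
    apply g.det_ne_zero
    have : g.val = -(X - Y) := eq_neg_of_add_eq_zero_left hg
    rw [this, Matrix.det_neg, h X hX Y hY, mul_zero]
  simp_rw [glHat_eq, mul_assoc] at h0
  rw [← Finset.mul_sum] at h0
  refine (mul_eq_zero.1 h0).resolve_left ?_
  exact_mod_cast Fintype.card_ne_zero

/-- The total Fourier weight of `A` on the matrices of rank one. -/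
noncomputable def rankOneWeight (A : Finset (Matrix (Fin k) (Fin k) F)) : ℝ :=
  ∑ R with R.rank = 1, Complex.normSq (setHat A R)

theorem rank_eq_zero_iff (R : Matrix (Fin k) (Fin k) F) : R.rank = 0 ↔ R = 0 := by
  constructor
  · intro h
    rw [Matrix.rank_eq_finrank_span_cols, Submodule.finrank_eq_zero, Submodule.span_eq_bot] at h
    ext i j
    exact congrFun (h _ ⟨j, rfl⟩) i
  · rintro rfl; exact Matrix.rank_zero

/-- Stability form of the ratio bound: a set of matrices with singular differences
has large Fourier weight on the matrices of rank one. -/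
theorem rankOneWeight_ge (hk : 2 ≤ k) (A : Finset (Matrix (Fin k) (Fin k) F))
    (h : ∀ X ∈ A, ∀ Y ∈ A, (X - Y).det = 0) :
    ((Fintype.card F : ℝ) ^ k - 1) * (A.card : ℝ) ^ 2 ≤ rankOneWeight A +
      1 / ((Fintype.card F : ℝ) ^ (k - 1) - 1) *
        ((Fintype.card F : ℝ) ^ (k ^ 2) * A.card - (A.card : ℝ) ^ 2 - rankOneWeight A) := by
  set q : ℝ := (Fintype.card F : ℝ) with hqdef
  have hq : 2 ≤ q := two_le_card
  have h1 := one_le_pow_sub_one hq (m := k) (by omega)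
  have h2 := one_le_pow_sub_one hq (m := k - 1) (by omega)
  have hsum := sum_rankEigenvalue_setHat A A h
  simp only [Complex.mul_conj, ← Complex.ofReal_mul, ← Complex.ofReal_sum] at hsum
  rw [Complex.ofReal_eq_zero] at hsum
  have hpars := sum_normSq_setHat A
  -- Rank 0 contributes a^2, rank 1 carries the eigenvalue -1 / (Q - 1), and the tail of rank at
  -- least 2 is controlled by its eigenvalue bound and Parseval.
  have hsplit : ∀ φ : Matrix (Fin k) (Fin k) F → ℝ, ∑ R, φ R = φ 0 + (∑ R with R.rank = 1, φ R +
      ∑ R with 2 ≤ R.rank, φ R) := by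
    intro φ
    rw [← Finset.add_sum_erase _ _ (Finset.mem_univ (0 : Matrix (Fin k) (Fin k) F))]
    congr 1
    rw [← Finset.sum_filter_add_sum_filter_not _ (fun R : Matrix (Fin k) (Fin k) F => R.rank = 1)]
    congr 1
    · refine Finset.sum_congr ?_ fun _ _ => rfl
      ext R
      simp only [mem_filter, mem_erase, mem_univ, and_true, true_and, and_iff_right_iff_imp]
      rintro hR rfl
      simp at hR
    · refine Finset.sum_congr ?_ fun _ _ => rfl
      ext R
      simp only [mem_filter, mem_erase, mem_univ, and_true, true_and]
      simp only [ne_eq, ← rank_eq_zero_iff R]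
      omega
  rw [hsplit] at hsum hpars
  have hr1 : ∑ R with R.rank = 1, rankEigenvalue q k R.rank * Complex.normSq (setHat A R) =
      -1 / (q ^ k - 1) * rankOneWeight A := by
    rw [rankOneWeight, Finset.mul_sum]
    refine Finset.sum_congr rfl fun R hR => ?_
    rw [(Finset.mem_filter.1 hR).2, rankEigenvalue_one]
  have hr2 : -∑ R with 2 ≤ R.rank, rankEigenvalue q k R.rank * Complex.normSq (setHat A R) ≤
      1 / ((q ^ k - 1) * (q ^ (k - 1) - 1)) *
        ∑ R with 2 ≤ R.rank, Complex.normSq (setHat A R) := by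
    rw [← Finset.sum_neg_distrib, Finset.mul_sum]
    refine Finset.sum_le_sum fun R hR => ?_
    rw [← neg_mul]
    refine mul_le_mul_of_nonneg_right ?_ (Complex.normSq_nonneg _)
    exact (neg_le_abs _).trans (abs_rankEigenvalue_le hq (Finset.mem_filter.1 hR).2
      (Matrix.rank_le_width R))
  rw [hr1] at hsum
  have hzero : Complex.normSq (setHat A 0) = (A.card : ℝ) ^ 2 := by
    simp [Complex.normSq_natCast, sq]
  rw [hzero] at hsum hpars
  simp only [Matrix.rank_zero, rankEigenvalue, one_mul] at hsum
  change _ + (rankOneWeight A + _) = _ at hpars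
  set w := rankOneWeight A
  set S := ∑ R with 2 ≤ R.rank, Complex.normSq (setHat A R)
  have hS : S = q ^ k ^ 2 * A.card - (A.card : ℝ) ^ 2 - w := by linarith
  rw [← hS]
  have h3 : (A.card : ℝ) ^ 2 - 1 / (q ^ k - 1) * w ≤
      1 / ((q ^ k - 1) * (q ^ (k - 1) - 1)) * S := by
    have : -1 / (q ^ k - 1) * w = - (1 / (q ^ k - 1) * w) := by ring
    linarith
  have h4 := mul_le_mul_of_nonneg_left h3 (by linarith : 0 ≤ q ^ k - 1)
  have e1 : (q ^ k - 1) * ((A.card : ℝ) ^ 2 - 1 / (q ^ k - 1) * w) =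
      (q ^ k - 1) * (A.card : ℝ) ^ 2 - w := by
    have : q ^ k - 1 ≠ 0 := by linarith
    field_simp
  have e2 : (q ^ k - 1) * (1 / ((q ^ k - 1) * (q ^ (k - 1) - 1)) * S) =
      1 / (q ^ (k - 1) - 1) * S := by
    have : q ^ k - 1 ≠ 0 := by linarith
    have : q ^ (k - 1) - 1 ≠ 0 := by linarith
    field_simp
  rw [e1, e2] at h4
  linarith

/-- Exchanging column j of R with v is an involution of the pairs (R, v). This replaces a sum over
frequencies by averages over one-column cosets. -/
theorem sum_updateCol {E : Type*} [AddCommMonoid E] (G : Matrix (Fin k) (Fin k) F → E)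
    (j : Fin k) :
    ∑ R : Matrix (Fin k) (Fin k) F, ∑ v, G (R.updateCol j v) = Fintype.card F ^ k • ∑ R, G R := by
  have hinv : ∀ p : Matrix (Fin k) (Fin k) F × (Fin k → F),
      ((p.1.updateCol j p.2).updateCol j (p.1.col j), (p.1.updateCol j p.2).col j) = p := by
    rintro ⟨R, v⟩
    refine Prod.ext ?_ ?_
    · ext a b
      by_cases hb : b = j
      · subst hb; simp [Matrix.col]
      · simp [hb]
    · ext a
      simp [Matrix.col]
  let e : Matrix (Fin k) (Fin k) F × (Fin k → F) ≃ Matrix (Fin k) (Fin k) F × (Fin k → F) :=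
    ⟨fun p => (p.1.updateCol j p.2, p.1.col j), fun p => (p.1.updateCol j p.2, p.1.col j),
      hinv, hinv⟩
  rw [← Fintype.sum_prod_type' (f := fun (R : Matrix (Fin k) (Fin k) F) v => G (R.updateCol j v))]
  rw [Fintype.sum_equiv e (fun p => G (p.1.updateCol j p.2)) (fun p => G p.1) (fun p => rfl),
    Fintype.sum_prod_type]
  simp [Finset.smul_sum]

theorem setHat_updateCol {A : Finset (Matrix (Fin k) (Fin k) F)} {j : Fin k} {x : Fin k → F}
    (hA : ∀ X ∈ A, X.col j = x) (R : Matrix (Fin k) (Fin k) F) (v : Fin k → F) :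
    setHat A (R.updateCol j v) = setHat A (R.updateCol j 0) * baseChar F (v ⬝ᵥ x) := by
  rw [setHat, setHat, Finset.sum_mul]
  refine Finset.sum_congr rfl fun X hX => ?_
  rw [matChar_updateCol, hA X hX]

/-- When column j is constant on A, changing column j of the frequency multiplies the transform by a
number of modulus 1 only. -/
theorem normSq_setHat_updateCol {A : Finset (Matrix (Fin k) (Fin k) F)} {j : Fin k}
    {x : Fin k → F} (hA : ∀ X ∈ A, X.col j = x) (R : Matrix (Fin k) (Fin k) F) (v : Fin k → F) :
    Complex.normSq (setHat A (R.updateCol j v)) = Complex.normSq (setHat A R) := by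
  have h : ∀ v, Complex.normSq (setHat A (R.updateCol j v)) =
      Complex.normSq (setHat A (R.updateCol j 0)) := by
    intro v
    rw [setHat_updateCol hA, Complex.normSq_mul, Complex.normSq_eq_norm_sq (baseChar F _),
      AddChar.norm_apply]
    simp
  have hR : R.updateCol j (R.col j) = R := by
    ext a b
    by_cases hb : b = j
    · subst hb; simp [Matrix.col]
    · simp [hb]
  rw [h v, ← h (R.col j), hR]

theorem colSpan_updateCol (R : Matrix (Fin k) (Fin k) F) (j : Fin k) (v : Fin k → F) :
    colSpan (R.updateCol j v) j = colSpan R j := by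
  unfold colSpan
  congr 1
  refine Set.image_congr fun i hi => ?_
  ext a
  have : i ≠ j := hi
  simp [Matrix.col, this]

theorem colSpan_eq_bot_iff (R : Matrix (Fin k) (Fin k) F) (j : Fin k) :
    colSpan R j = ⊥ ↔ ∃ v, (0 : Matrix (Fin k) (Fin k) F).updateCol j v = R := by
  constructor
  · intro h
    refine ⟨R.col j, ?_⟩
    rw [colSpan, Submodule.span_eq_bot] at h
    ext a b
    by_cases hb : b = j
    · subst hb; simp [Matrix.col]
    · have := congrFun (h _ ⟨b, hb, rfl⟩) a
      simp only [Matrix.col, Pi.zero_apply, Matrix.transpose_apply] at this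
      simp [hb, this]
  · rintro ⟨v, rfl⟩
    rw [colSpan_updateCol, colSpan, Submodule.span_eq_bot]
    rintro _ ⟨i, _, rfl⟩
    rfl

end SetTransform

/-! ### A cross-independent ratio bound for a set with one fixed column -/

section CrossBound

variable {F : Type*} [Field F] [Fintype F] [DecidableEq F] {k : ℕ}

/-- On frequencies supported in column j the transforms see only the distributions of that column,
and these have disjoint supports for A and B. -/
theorem sum_setHat_updateCol_zero (A B : Finset (Matrix (Fin k) (Fin k) F)) (j : Fin k)
    {x : Fin k → F} (hA : ∀ X ∈ A, X.col j = x) (hB : ∀ X ∈ B, X.col j ≠ x) :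
    ∑ v, setHat A ((0 : Matrix (Fin k) (Fin k) F).updateCol j v) *
      starRingEnd ℂ (setHat B ((0 : Matrix (Fin k) (Fin k) F).updateCol j v)) = 0 := by
  have h : ∀ v, setHat A ((0 : Matrix (Fin k) (Fin k) F).updateCol j v) *
      starRingEnd ℂ (setHat B ((0 : Matrix (Fin k) (Fin k) F).updateCol j v)) =
      ∑ X ∈ A, ∑ Y ∈ B, baseChar F (v ⬝ᵥ (X.col j - Y.col j)) := by
    intro v
    rw [setHat, setHat, map_sum, Finset.sum_mul_sum]
    refine Finset.sum_congr rfl fun X _ => Finset.sum_congr rfl fun Y _ => ?_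
    rw [matChar_updateCol, matChar_updateCol (X := Y), dotProduct_sub, sub_eq_add_neg,
      AddChar.map_add_eq_mul, AddChar.map_neg_eq_conj]
    have h0 : (0 : Matrix (Fin k) (Fin k) F).updateCol j 0 = 0 := by
      ext a b
      by_cases hb : b = j
      · subst hb; simp
      · simp [hb]
    simp [h0]
  simp_rw [h]
  rw [Finset.sum_comm]
  refine Finset.sum_eq_zero fun X hX => ?_
  rw [Finset.sum_comm]
  refine Finset.sum_eq_zero fun Y hY => ?_
  rw [sum_baseChar_dotProduct, if_neg]
  rw [hA X hX, sub_eq_zero]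
  exact fun h => hB Y hY h.symm

/-- Two sets of matrices with singular cross-differences, the first having its `j`-th column
constantly `x` and the second one never equal to `x`, cannot both be large. -/
theorem card_mul_card_le (hk : 2 ≤ k) (A B : Finset (Matrix (Fin k) (Fin k) F)) (j : Fin k)
    {x : Fin k → F} (hA : ∀ X ∈ A, X.col j = x) (hB : ∀ X ∈ B, X.col j ≠ x)
    (h : ∀ X ∈ A, ∀ Y ∈ B, (X - Y).det = 0) :
    (A.card : ℝ) * B.card * (((Fintype.card F : ℝ) ^ k) ^ 2 * ((Fintype.card F : ℝ) ^ (k - 1) - 1))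
      ≤ ((Fintype.card F : ℝ) ^ (k ^ 2)) ^ 2 := by
  classical
  set q : ℝ := (Fintype.card F : ℝ) with hqdef
  have hq : 2 ≤ q := two_le_card
  have h1 := one_le_pow_sub_one hq (m := k) (by omega)
  have h2 := one_le_pow_sub_one hq (m := k - 1) (by omega)
  set ω : Matrix (Fin k) (Fin k) F → ℝ := fun R => rankEigenvalue q k R.rank with hω
  set a : Matrix (Fin k) (Fin k) F → ℂ := setHat A
  set b : Matrix (Fin k) (Fin k) F → ℂ := setHat B
  have hsum : ∑ R, (ω R : ℂ) * (a R * starRingEnd ℂ (b R)) = 0 := sum_rankEigenvalue_setHat A B h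
  -- the part over the column `j`
  have hU : ∑ R with colSpan R j = ⊥, (ω R : ℂ) * (a R * starRingEnd ℂ (b R)) =
      (A.card * B.card * (q ^ k / (q ^ k - 1)) : ℝ) := by
    have himg : (univ.filter fun R : Matrix (Fin k) (Fin k) F => colSpan R j = ⊥) =
        univ.image (fun v => (0 : Matrix (Fin k) (Fin k) F).updateCol j v) := by
      ext R
      simp [colSpan_eq_bot_iff]
    have hinj : Function.Injective (fun v => (0 : Matrix (Fin k) (Fin k) F).updateCol j v) := by
      intro v w hvw
      ext i
      simpa using congrFun (congrFun hvw i) j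
    rw [himg, Finset.sum_image (fun v _ w _ hvw => hinj hvw)]
    have hz := sum_setHat_updateCol_zero A B j hA hB
    have h00 : (0 : Matrix (Fin k) (Fin k) F).updateCol j 0 = 0 := by
      ext a b
      by_cases hb : b = j
      · subst hb; simp
      · simp [hb]
    rw [← Finset.add_sum_erase _ _ (Finset.mem_univ (0 : Fin k → F))] at hz ⊢
    have hω1 : ∀ v ∈ univ.erase (0 : Fin k → F),
        (ω ((0 : Matrix (Fin k) (Fin k) F).updateCol j v) : ℂ) *
          (a ((0 : Matrix (Fin k) (Fin k) F).updateCol j v) *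
          starRingEnd ℂ (b ((0 : Matrix (Fin k) (Fin k) F).updateCol j v))) =
        ((-1 / (q ^ k - 1) : ℝ) : ℂ) *
          (setHat A ((0 : Matrix (Fin k) (Fin k) F).updateCol j v) *
          starRingEnd ℂ (setHat B ((0 : Matrix (Fin k) (Fin k) F).updateCol j v))) := by
      intro v hv
      have hv0 := Finset.ne_of_mem_erase hv
      have hbot : colSpan (0 : Matrix (Fin k) (Fin k) F) j = ⊥ :=
        (colSpan_eq_bot_iff _ _).2 ⟨0, h00⟩
      have hr := rank_updateCol (0 : Matrix (Fin k) (Fin k) F) j v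
      rw [hbot] at hr
      simp only [finrank_bot, Submodule.mem_bot, hv0, if_false, zero_add] at hr
      rw [hω]
      simp only [hr, rankEigenvalue_one]
      rfl
    rw [Finset.sum_congr rfl hω1, ← Finset.mul_sum, eq_neg_of_add_eq_zero_right hz, h00]
    simp only [ω, a, b, Matrix.rank_zero, rankEigenvalue, setHat_zero, map_natCast]
    have hne : ((q : ℂ)) ^ k - 1 ≠ 0 := by
      have : q ^ k - 1 ≠ 0 := by linarith
      exact_mod_cast this
    push_cast
    field_simp
    ring
  rw [← Finset.sum_filter_add_sum_filter_not _ (fun R => colSpan R j = ⊥), hU] at hsum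
  set s : Finset (Matrix (Fin k) (Fin k) F) := univ.filter (fun R => ¬ colSpan R j = ⊥) with hs
  -- Cauchy-Schwarz on the rest
  have hcs : (A.card * B.card * (q ^ k / (q ^ k - 1)) : ℝ) ^ 2 ≤
      (∑ R ∈ s, ω R ^ 2 * Complex.normSq (a R)) * ∑ R ∈ s, Complex.normSq (b R) := by
    have e1 : (A.card * B.card * (q ^ k / (q ^ k - 1)) : ℝ) ≤ ∑ R ∈ s, (|ω R| * ‖a R‖) * ‖b R‖ := by
      have e2 := eq_neg_of_add_eq_zero_left hsum
      have e3 := congrArg norm e2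
      rw [Complex.norm_real, norm_neg] at e3
      refine (le_abs_self _).trans (e3.le.trans ?_)
      refine (norm_sum_le _ _).trans (Finset.sum_le_sum fun R _ => ?_)
      simp [mul_assoc]
    have e0 : 0 ≤ (A.card * B.card * (q ^ k / (q ^ k - 1)) : ℝ) := by positivity
    refine (pow_le_pow_left₀ e0 e1 2).trans ?_
    refine (Finset.sum_mul_sq_le_sq_mul_sq _ _ _).trans (le_of_eq ?_)
    congr 1
    · refine Finset.sum_congr rfl fun R _ => ?_
      rw [mul_pow, sq_abs, Complex.normSq_eq_norm_sq]
    · refine Finset.sum_congr rfl fun R _ => ?_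
      rw [Complex.normSq_eq_norm_sq]
  have hb : ∑ R ∈ s, Complex.normSq (b R) ≤ q ^ (k ^ 2) * B.card := by
    rw [← sum_normSq_setHat]
    exact Finset.sum_le_sum_of_subset_of_nonneg (Finset.subset_univ _)
      fun _ _ _ => Complex.normSq_nonneg _
  -- The energy of A is constant along one-column cosets, so the squared eigenvalue may be replaced
  -- by its coset average. Every coset left in `s` has d ≥ 1.
  have ha : q ^ k * (∑ R ∈ s, ω R ^ 2 * Complex.normSq (a R)) ≤
      q ^ k / ((q ^ k - 1) ^ 2 * (q ^ (k - 1) - 1)) * (q ^ (k ^ 2) * A.card) := by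
    have e1 := sum_updateCol (fun R => if colSpan R j = ⊥ then 0 else
      ω R ^ 2 * Complex.normSq (a R)) j
    have e2 : ∑ R ∈ s, ω R ^ 2 * Complex.normSq (a R) = ∑ R, if colSpan R j = ⊥ then 0 else
      ω R ^ 2 * Complex.normSq (a R) := by
      rw [hs, Finset.sum_filter]
      refine Finset.sum_congr rfl fun R _ => ?_
      split_ifs <;> rfl
    have e3 : q ^ k * (∑ R ∈ s, ω R ^ 2 * Complex.normSq (a R)) =
        ∑ R : Matrix (Fin k) (Fin k) F, ∑ v, if colSpan (R.updateCol j v) j = ⊥ then 0 else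
          ω (R.updateCol j v) ^ 2 * Complex.normSq (a (R.updateCol j v)) := by
      rw [e2, e1]
      simp [q]
    rw [e3, ← sum_normSq_setHat, Finset.mul_sum]
    refine Finset.sum_le_sum fun R _ => ?_
    simp only [colSpan_updateCol, a, normSq_setHat_updateCol hA]
    split_ifs with hbot
    · simp only [Finset.sum_const_zero]
      have := Complex.normSq_nonneg (setHat A R)
      positivity
    · rw [← Finset.sum_mul]
      refine mul_le_mul_of_nonneg_right ?_ (Complex.normSq_nonneg _)
      have := sum_rank_updateCol (fun m => rankEigenvalue q k m ^ 2) R j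
      simp only [hω]
      rw [this]
      refine rankEigenvalue_sq_coset_le hq ?_ (finrank_colSpan_lt R j)
      rw [Nat.one_le_iff_ne_zero]
      exact fun h0 => hbot (Submodule.finrank_eq_zero.1 h0)
  set SA := ∑ R ∈ s, ω R ^ 2 * Complex.normSq (a R)
  have hSA0 : 0 ≤ SA := Finset.sum_nonneg fun R _ =>
    mul_nonneg (sq_nonneg _) (Complex.normSq_nonneg _)
  have hQ : 0 < q ^ k := by positivity
  set Q := q ^ k
  set P := q ^ (k - 1) - 1
  set n := q ^ (k ^ 2)
  have hn : 0 < n := by positivity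
  have ha' : SA ≤ n * A.card / ((Q - 1) ^ 2 * P) := by
    have : Q * SA ≤ Q * (n * A.card / ((Q - 1) ^ 2 * P)) := by
      refine ha.trans (le_of_eq ?_)
      ring
    exact le_of_mul_le_mul_left this hQ
  have hfin : (A.card * B.card * (Q / (Q - 1)) : ℝ) ^ 2 ≤
      n * A.card / ((Q - 1) ^ 2 * P) * (n * B.card) :=
    hcs.trans (mul_le_mul ha' hb (Finset.sum_nonneg fun _ _ => Complex.normSq_nonneg _)
      (hSA0.trans ha'))
  have hden : 0 < (Q - 1) ^ 2 * P := by
    have : 0 < Q - 1 := by linarith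
    have : 0 < P := by linarith
    positivity
  have hfin2 : ((A.card : ℝ) * B.card) * ((A.card * B.card) * (Q ^ 2 * P)) ≤
      ((A.card : ℝ) * B.card) * n ^ 2 := by
    have e := mul_le_mul_of_nonneg_left hfin hden.le
    have hQ1 : Q - 1 ≠ 0 := by linarith
    have hP : P ≠ 0 := by linarith
    have l : ((Q - 1) ^ 2 * P) * (A.card * B.card * (Q / (Q - 1)) : ℝ) ^ 2 =
        ((A.card : ℝ) * B.card) * ((A.card * B.card) * (Q ^ 2 * P)) := by
      field_simp
    have r : ((Q - 1) ^ 2 * P) * (n * A.card / ((Q - 1) ^ 2 * P) * (n * B.card)) =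
        ((A.card : ℝ) * B.card) * n ^ 2 := by
      field_simp
    rw [l, r] at e
    exact e
  rcases (by positivity : (0 : ℝ) ≤ (A.card : ℝ) * B.card).eq_or_lt with h0 | h0
  · rw [← h0]
    simp only [zero_mul]
    positivity
  · exact le_of_mul_le_mul_left hfin2 h0

end CrossBound

/-! ### Sums over projective points -/

section ProjectiveSums

variable {F : Type*} [Field F] [Fintype F] [DecidableEq F] {k : ℕ}

noncomputable instance projFintype (F V : Type*) [Field F] [AddCommGroup V] [Module F V]
    [Finite V] : Fintype (ℙ F V) := Fintype.ofFinite _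

noncomputable instance projDecidableEq (F V : Type*) [Field F] [AddCommGroup V] [Module F V] :
    DecidableEq (ℙ F V) := Classical.decEq _

theorem bijective_smul_rep (V : Type*) [AddCommGroup V] [Module F V] :
    Function.Bijective (fun x : ℙ F V × Fˣ =>
      (⟨(x.2 : F) • x.1.rep, smul_ne_zero x.2.ne_zero x.1.rep_nonzero⟩ : {v : V // v ≠ 0})) := by
  constructor
  · rintro ⟨p, s⟩ ⟨p', s'⟩ h
    have h' : (s : F) • p.rep = (s' : F) • p'.rep := congrArg Subtype.val h
    have hp : p = p' := by
      rw [← p.mk_rep, ← p'.mk_rep, Projectivization.mk_eq_mk_iff]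
      refine ⟨s⁻¹ * s', ?_⟩
      rw [mul_smul, Units.smul_def s', ← h', ← Units.smul_def, inv_smul_smul]
    subst hp
    have : (s : F) = s' := smul_left_injective F p.rep_nonzero h'
    rw [Units.ext this]
  · rintro ⟨v, hv⟩
    obtain ⟨s, hs⟩ := Projectivization.exists_smul_eq_mk_rep F v hv
    refine ⟨⟨Projectivization.mk F v hv, s⁻¹⟩, Subtype.ext ?_⟩
    simp only
    rw [← hs, ← Units.smul_def, inv_smul_smul]

theorem sum_ne_zero_eq_sum_proj {V : Type*} [AddCommGroup V] [Module F V] [Fintype V]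
    [DecidableEq V] {E : Type*} [AddCommMonoid E] (φ : V → E) :
    ∑ v with v ≠ 0, φ v = ∑ p : ℙ F V, ∑ s : Fˣ, φ ((s : F) • p.rep) := by
  rw [← Fintype.sum_prod_type' (f := fun (p : ℙ F V) (s : Fˣ) => φ ((s : F) • p.rep)),
    Fintype.sum_bijective _ (bijective_smul_rep V) _ (fun v => φ v.1) (fun _ => rfl)]
  exact (Finset.sum_subtype _ (by simp) φ)

theorem card_units_real : (Fintype.card Fˣ : ℝ) = Fintype.card F - 1 := by
  rw [Fintype.card_units, Nat.cast_sub Fintype.card_pos, Nat.cast_one]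

theorem card_proj_mul :
    (Fintype.card (ℙ F (Fin k → F)) : ℝ) * (Fintype.card F - 1) = (Fintype.card F : ℝ) ^ k - 1 := by
  have h := sum_ne_zero_eq_sum_proj (F := F) (V := Fin k → F) (fun _ => (1 : ℝ))
  simp only [Finset.sum_const, nsmul_eq_mul, mul_one, Finset.card_univ, card_units_real] at h
  rw [← h, Finset.filter_ne' , Finset.card_erase_of_mem (Finset.mem_univ _), Finset.card_univ,
    Nat.cast_sub Fintype.card_pos]
  simp

/-- The number of vectors orthogonal to `w`, weighted as in the sums below. -/
theorem sum_dotProduct_eq_zero (w : Fin k → F) :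
    ∑ v : Fin k → F, ((Fintype.card F : ℝ) * (if v ⬝ᵥ w = 0 then 1 else 0) - 1) =
      if w = 0 then ((Fintype.card F : ℝ) - 1) * (Fintype.card F : ℝ) ^ k else 0 := by
  have h : ∀ v : Fin k → F, (Fintype.card F : ℂ) * (if v ⬝ᵥ w = 0 then 1 else 0) =
      ∑ t : F, baseChar F (v ⬝ᵥ (t • w)) := by
    intro v
    have := sum_baseChar_linear (LinearMap.toSpanSingleton F F (v ⬝ᵥ w))
    simp only [LinearMap.toSpanSingleton_apply] at this
    simp only [dotProduct_smul]
    rw [this]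
    have hiff : LinearMap.toSpanSingleton F F (v ⬝ᵥ w) = 0 ↔ v ⬝ᵥ w = 0 := by
      rw [LinearMap.toSpanSingleton_eq_zero_iff]
    simp [hiff]
  have hC : ∑ v : Fin k → F, ((Fintype.card F : ℂ) * (if v ⬝ᵥ w = 0 then 1 else 0) - 1) =
      if w = 0 then ((Fintype.card F : ℂ) - 1) * (Fintype.card F : ℂ) ^ k else 0 := by
    rw [Finset.sum_sub_distrib]
    simp_rw [h]
    rw [Finset.sum_comm]
    simp_rw [sum_baseChar_dotProduct, smul_eq_zero]
    by_cases hw : w = 0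
    · simp [hw]
      ring
    · simp [hw]
  split_ifs at hC ⊢ <;> exact_mod_cast hC

/-- The condition is invariant under scaling, so this is the vector identity with v = 0 removed,
divided by the q - 1 multiples of each representative. -/
theorem sum_proj_dotProduct (w : Fin k → F) :
    ∑ p : ℙ F (Fin k → F), ((Fintype.card F : ℝ) * (if p.rep ⬝ᵥ w = 0 then 1 else 0) - 1) =
      (Fintype.card F : ℝ) ^ k * (if w = 0 then 1 else 0) - 1 := by
  have h1 := sum_dotProduct_eq_zero w
  rw [← Finset.sum_filter_add_sum_filter_not _ (fun v => v ≠ 0),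
    sum_ne_zero_eq_sum_proj (F := F)] at h1
  simp only [smul_dotProduct, smul_eq_mul, mul_eq_zero, Units.ne_zero, false_or,
    Finset.sum_const, Finset.card_univ, nsmul_eq_mul, card_units_real, ne_eq, not_not] at h1
  rw [← Finset.mul_sum, Finset.filter_eq'] at h1
  simp only [Finset.mem_univ, if_true, Finset.sum_singleton, zero_dotProduct, mul_one] at h1
  have hq := two_le_card (F := F)
  have hq1 : (Fintype.card F : ℝ) - 1 ≠ 0 := by linarith
  apply mul_left_cancel₀ hq1
  split_ifs at h1 ⊢ <;> linarith

/-- Were every 2 × 2 minor of the two representatives zero, the points would coincide. A non-zero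
minor supplies x with two non-zero coordinates at most. -/
theorem exists_dotProduct_rep {p p' : ℙ F (Fin k → F)} (h : p ≠ p') :
    ∃ x : Fin k → F, p.rep ⬝ᵥ x = 1 ∧ p'.rep ⬝ᵥ x = 0 := by
  by_contra! hc
  obtain ⟨i, hi⟩ := Function.ne_iff.1 p'.rep_nonzero
  have hall : ∀ j, p.rep i * p'.rep j = p.rep j * p'.rep i := by
    intro j
    by_contra hne
    have hne' : p.rep i * p'.rep j - p.rep j * p'.rep i ≠ 0 := sub_ne_zero.2 hne
    refine hc ((p.rep i * p'.rep j - p.rep j * p'.rep i)⁻¹ •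
      (p'.rep j • Pi.single i 1 - p'.rep i • Pi.single j 1)) ?_ ?_
    · simp only [dotProduct_smul, dotProduct_sub, dotProduct_single, smul_eq_mul, mul_one]
      rw [mul_comm (p'.rep j), mul_comm (p'.rep i), inv_mul_cancel₀ hne']
    · simp only [dotProduct_smul, dotProduct_sub, dotProduct_single, smul_eq_mul, mul_one]
      ring
  have hpi : p.rep i ≠ 0 := by
    intro h0
    apply p.rep_nonzero
    ext j
    have := hall j
    rw [h0, zero_mul] at this
    exact (mul_eq_zero.1 this.symm).resolve_right hi
  apply h
  rw [← p.mk_rep, ← p'.mk_rep, Projectivization.mk_eq_mk_iff']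
  refine ⟨p.rep i / p'.rep i, ?_⟩
  ext j
  simp only [Pi.smul_apply, smul_eq_mul]
  rw [div_mul_eq_mul_div, hall j, mul_div_assoc, div_self hi, mul_one]

theorem exists_dotProduct_rep_one (p : ℙ F (Fin k → F)) : ∃ x : Fin k → F, p.rep ⬝ᵥ x = 1 := by
  obtain ⟨i, hi⟩ := Function.ne_iff.1 p.rep_nonzero
  exact ⟨Pi.single i (p.rep i)⁻¹, by rw [dotProduct_single, mul_inv_cancel₀ hi]⟩

end ProjectiveSums

/-! ### Decomposition of the rank-one level into line parts, and its third moment -/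

section LineParts

variable {F : Type*} [Field F] [Fintype F] [DecidableEq F] {k : ℕ}

/-- The bilinear form `pᵀ X r` attached to two points `p` and `r`. -/
noncomputable def lineForm (p r : ℙ F (Fin k → F)) (X : Matrix (Fin k) (Fin k) F) : F :=
  p.rep ⬝ᵥ (X *ᵥ r.rep)

/-- The centred (and scaled) conditional expectation of the indicator of `A` given `pᵀ X r`. -/
noncomputable def linePart (A : Finset (Matrix (Fin k) (Fin k) F)) (p r : ℙ F (Fin k → F))
    (X : Matrix (Fin k) (Fin k) F) : ℝ :=
  ∑ Y ∈ A, ((Fintype.card F : ℝ) * (if lineForm p r Y = lineForm p r X then 1 else 0) - 1)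

theorem lineForm_add_smul (p r : ℙ F (Fin k → F)) (X Z : Matrix (Fin k) (Fin k) F) (t : F) :
    lineForm p r (X + t • Z) = lineForm p r X + t * lineForm p r Z := by
  simp [lineForm, Matrix.add_mulVec, Matrix.smul_mulVec]

theorem lineForm_sub (p r : ℙ F (Fin k → F)) (X Z : Matrix (Fin k) (Fin k) F) :
    lineForm p r (X - Z) = lineForm p r X - lineForm p r Z := by
  simp [lineForm, Matrix.sub_mulVec]

theorem lineForm_vecMulVec (p r : ℙ F (Fin k → F)) (x y : Fin k → F) :
    lineForm p r (vecMulVec x y) = (p.rep ⬝ᵥ x) * (r.rep ⬝ᵥ y) := by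
  rw [lineForm, Matrix.vecMulVec_mulVec, dotProduct_comm y]
  simp [mul_comm]

theorem sum_line_shift (a b : F) :
    ∑ t : F, ((Fintype.card F : ℝ) * (if a = b + t then 1 else 0) - 1) = 0 := by
  rw [Finset.sum_sub_distrib, ← Finset.mul_sum]
  have : ∀ t : F, (a = b + t) ↔ (t = a - b) := fun t => by
    rw [eq_sub_iff_add_eq', eq_comm]
  simp [this]

/-- A line part is orthogonal to every function that is invariant under a translation on which
its linear form does not vanish. -/
theorem sum_linePart_mul_eq_zero (A : Finset (Matrix (Fin k) (Fin k) F)) (p r : ℙ F (Fin k → F))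
    (Z : Matrix (Fin k) (Fin k) F) (hZ : lineForm p r Z = 1)
    (G : Matrix (Fin k) (Fin k) F → ℝ) (hG : ∀ X (t : F), G (X + t • Z) = G X) :
    ∑ X, linePart A p r X * G X = 0 := by
  have h1 : ∀ t : F, ∑ X, linePart A p r (X + t • Z) * G X = ∑ X, linePart A p r X * G X := by
    intro t
    rw [← Equiv.sum_comp (Equiv.addRight (t • Z)) (fun X => linePart A p r X * G X)]
    refine Finset.sum_congr rfl fun X _ => ?_
    simp [hG]
  have h2 : ∑ t : F, ∑ X, linePart A p r (X + t • Z) * G X = 0 := by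
    rw [Finset.sum_comm]
    refine Finset.sum_eq_zero fun X _ => ?_
    rw [← Finset.sum_mul]
    simp only [linePart]
    rw [Finset.sum_comm, Finset.sum_eq_zero, zero_mul]
    intro Y _
    simp only [lineForm_add_smul, hZ, mul_one]
    exact sum_line_shift _ _
  simp_rw [h1] at h2
  rw [Finset.sum_const, nsmul_eq_mul] at h2
  refine (mul_eq_zero.1 h2).resolve_left ?_
  exact_mod_cast (Finset.card_ne_zero_of_mem (Finset.mem_univ (0 : F)))

theorem linePart_add_smul (A : Finset (Matrix (Fin k) (Fin k) F)) (p r : ℙ F (Fin k → F))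
    (X Z : Matrix (Fin k) (Fin k) F) (t : F) (hZ : lineForm p r Z = 0) :
    linePart A p r (X + t • Z) = linePart A p r X := by
  simp [linePart, lineForm_add_smul, hZ]

/-- A rank-one translation can change one linear form while fixing the other, so distinct line parts
are orthogonal. -/
theorem sum_linePart_mul (A : Finset (Matrix (Fin k) (Fin k) F)) {p r p' r' : ℙ F (Fin k → F)}
    (h : ¬ (p = p' ∧ r = r')) :
    ∑ X, linePart A p r X * linePart A p' r' X = 0 := by
  obtain ⟨Z, hZ, hZ'⟩ : ∃ Z, lineForm p r Z = 1 ∧ lineForm p' r' Z = 0 := by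
    by_cases hp : p = p'
    · obtain ⟨x, hx⟩ := exists_dotProduct_rep_one p
      obtain ⟨y, hy, hy'⟩ := exists_dotProduct_rep (fun hr => h ⟨hp, hr⟩ : r ≠ r')
      exact ⟨vecMulVec x y, by rw [lineForm_vecMulVec, hx, hy, one_mul],
        by rw [lineForm_vecMulVec, hy', mul_zero]⟩
    · obtain ⟨x, hx, hx'⟩ := exists_dotProduct_rep hp
      obtain ⟨y, hy⟩ := exists_dotProduct_rep_one r
      exact ⟨vecMulVec x y, by rw [lineForm_vecMulVec, hx, hy, one_mul],
        by rw [lineForm_vecMulVec, hx', zero_mul]⟩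
  exact sum_linePart_mul_eq_zero A p r Z hZ _ fun X t => linePart_add_smul A _ _ _ _ _ hZ'

/-- One of the three pairs can be separated from a second by its point p and from the third by its
point r. The translation x yᵀ, with x killing the second form and y the third, then moves only the
first form. -/
theorem sum_linePart_mul_mul (A : Finset (Matrix (Fin k) (Fin k) F))
    {p₁ p₂ p₃ r₁ r₂ r₃ : ℙ F (Fin k → F)} (hp : ¬ (p₁ = p₂ ∧ p₁ = p₃))
    (hr : ¬ (r₁ = r₂ ∧ r₁ = r₃)) :
    ∑ X, linePart A p₁ r₁ X * linePart A p₂ r₂ X * linePart A p₃ r₃ X = 0 := by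
  have key : ∀ {p₁ p₂ p₃ r₁ r₂ r₃ : ℙ F (Fin k → F)}, p₁ ≠ p₂ → r₁ ≠ r₃ →
      ∑ X, linePart A p₁ r₁ X * (linePart A p₂ r₂ X * linePart A p₃ r₃ X) = 0 := by
    intro p₁ p₂ p₃ r₁ r₂ r₃ h1 h2
    obtain ⟨x, hx, hx'⟩ := exists_dotProduct_rep h1
    obtain ⟨y, hy, hy'⟩ := exists_dotProduct_rep h2
    refine sum_linePart_mul_eq_zero A p₁ r₁ (vecMulVec x y)
      (by rw [lineForm_vecMulVec, hx, hy, one_mul]) _ fun X t => ?_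
    rw [linePart_add_smul _ _ _ _ _ _ (by rw [lineForm_vecMulVec, hx', zero_mul]),
      linePart_add_smul _ _ _ _ _ _ (by rw [lineForm_vecMulVec, hy', mul_zero])]
  have hcases : (p₁ ≠ p₂ ∧ r₁ ≠ r₃) ∨ (p₁ ≠ p₃ ∧ r₁ ≠ r₂) ∨ (p₂ ≠ p₁ ∧ r₂ ≠ r₃) ∨
      (p₂ ≠ p₃ ∧ r₂ ≠ r₁) ∨ (p₃ ≠ p₁ ∧ r₃ ≠ r₂) ∨ (p₃ ≠ p₂ ∧ r₃ ≠ r₁) := by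
    grind
  rcases hcases with h | h | h | h | h | h
  · rw [← key (p₃ := p₃) (r₂ := r₂) h.1 h.2]
    exact Finset.sum_congr rfl fun X _ => by ring
  · rw [← key (p₃ := p₂) (r₂ := r₃) h.1 h.2]
    exact Finset.sum_congr rfl fun X _ => by ring
  · rw [← key (p₃ := p₃) (r₂ := r₁) h.1 h.2]
    exact Finset.sum_congr rfl fun X _ => by ring
  · rw [← key (p₃ := p₁) (r₂ := r₃) h.1 h.2]
    exact Finset.sum_congr rfl fun X _ => by ring
  · rw [← key (p₃ := p₂) (r₂ := r₁) h.1 h.2]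
    exact Finset.sum_congr rfl fun X _ => by ring
  · rw [← key (p₃ := p₁) (r₂ := r₂) h.1 h.2]
    exact Finset.sum_congr rfl fun X _ => by ring

/-- The sum of all line parts. -/
noncomputable def levelOne (A : Finset (Matrix (Fin k) (Fin k) F))
    (X : Matrix (Fin k) (Fin k) F) : ℝ :=
  ∑ p, ∑ r, linePart A p r X

/-- Knowing pᵀ X r for all p amounts to knowing X r. The sum is therefore the centred count of
members with the same image of r, and degree bounds apply to it. -/
theorem sum_linePart_left (A : Finset (Matrix (Fin k) (Fin k) F)) (r : ℙ F (Fin k → F))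
    (X : Matrix (Fin k) (Fin k) F) :
    ∑ p, linePart A p r X = (Fintype.card F : ℝ) ^ k *
      (A.filter fun Y => Y *ᵥ r.rep = X *ᵥ r.rep).card - A.card := by
  simp only [linePart]
  rw [Finset.sum_comm]
  have h : ∀ Y ∈ A, ∑ p : ℙ F (Fin k → F), ((Fintype.card F : ℝ) *
      (if lineForm p r Y = lineForm p r X then 1 else 0) - 1) =
      (Fintype.card F : ℝ) ^ k * (if Y *ᵥ r.rep = X *ᵥ r.rep then 1 else 0) - 1 := by
    intro Y _
    have := sum_proj_dotProduct (F := F) (Y *ᵥ r.rep - X *ᵥ r.rep)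
    simp only [dotProduct_sub, sub_eq_zero] at this
    exact this
  rw [Finset.sum_congr rfl h, Finset.sum_sub_distrib, ← Finset.mul_sum]
  simp

theorem lineForm_eq_vecMul (p r : ℙ F (Fin k → F)) (X : Matrix (Fin k) (Fin k) F) :
    lineForm p r X = r.rep ⬝ᵥ (p.rep ᵥ* X) := by
  rw [lineForm, Matrix.dotProduct_mulVec, dotProduct_comm]

theorem sum_linePart_right (A : Finset (Matrix (Fin k) (Fin k) F)) (p : ℙ F (Fin k → F))
    (X : Matrix (Fin k) (Fin k) F) :
    ∑ r, linePart A p r X = (Fintype.card F : ℝ) ^ k *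
      (A.filter fun Y => p.rep ᵥ* Y = p.rep ᵥ* X).card - A.card := by
  simp only [linePart]
  rw [Finset.sum_comm]
  have h : ∀ Y ∈ A, ∑ r : ℙ F (Fin k → F), ((Fintype.card F : ℝ) *
      (if lineForm p r Y = lineForm p r X then 1 else 0) - 1) =
      (Fintype.card F : ℝ) ^ k * (if p.rep ᵥ* Y = p.rep ᵥ* X then 1 else 0) - 1 := by
    intro Y _
    have := sum_proj_dotProduct (F := F) (p.rep ᵥ* Y - p.rep ᵥ* X)
    simp only [dotProduct_sub, sub_eq_zero] at this
    simp only [lineForm_eq_vecMul]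
    exact this
  rw [Finset.sum_congr rfl h, Finset.sum_sub_distrib, ← Finset.mul_sum]
  simp

theorem neg_card_le_linePart (A : Finset (Matrix (Fin k) (Fin k) F)) (p r : ℙ F (Fin k → F))
    (X : Matrix (Fin k) (Fin k) F) : -(A.card : ℝ) ≤ linePart A p r X := by
  rw [linePart, Finset.sum_sub_distrib, ← Finset.mul_sum]
  simp only [Finset.sum_const, nsmul_eq_mul, mul_one]
  have : (0 : ℝ) ≤ (Fintype.card F : ℝ) *
      ∑ Y ∈ A, (if lineForm p r Y = lineForm p r X then (1 : ℝ) else 0) := by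
    refine mul_nonneg (by positivity) (Finset.sum_nonneg fun _ _ => ?_)
    split_ifs <;> norm_num
  linarith

/-- Grouping by p first costs only |A| per point. Bounding the line parts one by one would lose
another factor of the number of points. -/
theorem levelOne_ge (A : Finset (Matrix (Fin k) (Fin k) F)) (X : Matrix (Fin k) (Fin k) F) :
    -(Fintype.card (ℙ F (Fin k → F)) * A.card : ℝ) ≤ levelOne A X := by
  have : ∀ p ∈ (univ : Finset (ℙ F (Fin k → F))), -(A.card : ℝ) ≤ ∑ r, linePart A p r X := by
    intro p _
    rw [sum_linePart_right]
    have : (0 : ℝ) ≤ (Fintype.card F : ℝ) ^ k *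
      (A.filter fun Y => p.rep ᵥ* Y = p.rep ᵥ* X).card := by positivity
    linarith
  have h := Finset.card_nsmul_le_sum _ _ _ this
  rw [Finset.card_univ, nsmul_eq_mul] at h
  rw [levelOne]
  linarith

theorem sum_levelOne_sq (A : Finset (Matrix (Fin k) (Fin k) F)) :
    ∑ X, levelOne A X ^ 2 = ∑ p, ∑ r, ∑ X, linePart A p r X ^ 2 := by
  have h : ∀ X, levelOne A X ^ 2 =
      ∑ p, ∑ r, ∑ p', ∑ r', linePart A p r X * linePart A p' r' X := by
    intro X
    rw [sq, levelOne, Finset.sum_mul]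
    refine Finset.sum_congr rfl fun p _ => ?_
    rw [Finset.sum_mul]
    refine Finset.sum_congr rfl fun r _ => ?_
    simp_rw [Finset.mul_sum]
  simp_rw [h]
  rw [Finset.sum_comm]
  refine Finset.sum_congr rfl fun p _ => ?_
  rw [Finset.sum_comm]
  refine Finset.sum_congr rfl fun r _ => ?_
  rw [Finset.sum_comm, Finset.sum_eq_single p]
  · rw [Finset.sum_comm, Finset.sum_eq_single r]
    · simp [sq]
    · intro r' _ hr
      exact sum_linePart_mul A (fun h => hr h.2.symm)
    · simp
  · intro p' _ hp
    rw [Finset.sum_comm]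
    refine Finset.sum_eq_zero fun r' _ => ?_
    exact sum_linePart_mul A (fun h => hp h.1.symm)
  · simp

theorem sum_left_sq (A : Finset (Matrix (Fin k) (Fin k) F)) (r : ℙ F (Fin k → F)) :
    ∑ X, (∑ p, linePart A p r X) ^ 2 = ∑ p, ∑ X, linePart A p r X ^ 2 := by
  simp_rw [sq, Finset.sum_mul_sum]
  rw [Finset.sum_comm]
  refine Finset.sum_congr rfl fun p _ => ?_
  rw [Finset.sum_comm, Finset.sum_eq_single p]
  · intro p' _ hp
    exact sum_linePart_mul A (fun h => hp h.1.symm)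
  · simp

theorem sum_right_sq (A : Finset (Matrix (Fin k) (Fin k) F)) (p : ℙ F (Fin k → F)) :
    ∑ X, (∑ r, linePart A p r X) ^ 2 = ∑ r, ∑ X, linePart A p r X ^ 2 := by
  simp_rw [sq, Finset.sum_mul_sum]
  rw [Finset.sum_comm]
  refine Finset.sum_congr rfl fun p _ => ?_
  rw [Finset.sum_comm, Finset.sum_eq_single p]
  · intro p' _ hp
    exact sum_linePart_mul A (fun h => hp h.2.symm)
  · simp

theorem sum_pow_three {ι : Type*} (s : Finset ι) (g : ι → ℝ) :
    (∑ i ∈ s, g i) ^ 3 = ∑ i ∈ s, ∑ j ∈ s, ∑ l ∈ s, g i * g j * g l := by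
  rw [pow_succ, sq, Finset.sum_mul_sum, Finset.sum_mul]
  refine Finset.sum_congr rfl fun i _ => ?_
  rw [Finset.sum_mul]
  refine Finset.sum_congr rfl fun j _ => ?_
  rw [Finset.mul_sum]

theorem sum_sum_ite_fst {α β : Type*} [Fintype α] [Fintype β] [DecidableEq α] (p : α)
    (φ : α × β → α × β → ℝ) :
    ∑ b, ∑ c, (if p = b.1 ∧ p = c.1 then φ b c else 0) = ∑ r, ∑ r', φ (p, r) (p, r') := by
  rw [Fintype.sum_prod_type, Finset.sum_eq_single p]
  · refine Finset.sum_congr rfl fun r _ => ?_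
    rw [Fintype.sum_prod_type, Finset.sum_eq_single p]
    · simp
    · intro p' _ hp
      refine Finset.sum_eq_zero fun c _ => ?_
      rw [if_neg (fun h => hp h.2.symm)]
    · simp
  · intro p' _ hp
    refine Finset.sum_eq_zero fun b _ => Finset.sum_eq_zero fun c _ => ?_
    rw [if_neg (fun h => hp h.1.symm)]
  · simp

theorem sum_sum_ite_snd {α β : Type*} [Fintype α] [Fintype β] [DecidableEq β] (r : β)
    (φ : α × β → α × β → ℝ) :
    ∑ b, ∑ c, (if r = b.2 ∧ r = c.2 then φ b c else 0) = ∑ p, ∑ p', φ (p, r) (p', r) := by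
  rw [Fintype.sum_prod_type]
  refine Finset.sum_congr rfl fun p _ => ?_
  rw [Finset.sum_eq_single r]
  · rw [Fintype.sum_prod_type]
    refine Finset.sum_congr rfl fun p' _ => ?_
    rw [Finset.sum_eq_single r]
    · simp
    · intro r' _ hr
      rw [if_neg (fun h => hr h.2.symm)]
    · simp
  · intro r' _ hr
    refine Finset.sum_eq_zero fun c _ => ?_
    rw [if_neg (fun h => hr h.1.symm)]
  · simp

theorem sum_sum_pow_three {ι κ : Type*} [Fintype ι] [Fintype κ] (g : ι → κ → ℝ) :
    ∑ X, (∑ i, g i X) ^ 3 = ∑ i, ∑ j, ∑ l, ∑ X, g i X * g j X * g l X := by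
  simp_rw [sum_pow_three]
  rw [Finset.sum_comm]
  refine Finset.sum_congr rfl fun a _ => ?_
  rw [Finset.sum_comm]
  refine Finset.sum_congr rfl fun b _ => ?_
  rw [Finset.sum_comm]

/-- The third moment of the level one part is concentrated on triples of line parts having
a common point or a common hyperplane. -/
theorem sum_levelOne_pow_three (A : Finset (Matrix (Fin k) (Fin k) F)) :
    ∑ X, levelOne A X ^ 3 = ∑ r, ∑ X, (∑ p, linePart A p r X) ^ 3 +
      ∑ p, ∑ X, (∑ r, linePart A p r X) ^ 3 - ∑ p, ∑ r, ∑ X, linePart A p r X ^ 3 := by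
  set T : ℙ F (Fin k → F) × ℙ F (Fin k → F) → ℙ F (Fin k → F) × ℙ F (Fin k → F) →
      ℙ F (Fin k → F) × ℙ F (Fin k → F) → ℝ := fun a b c =>
    ∑ X, linePart A a.1 a.2 X * linePart A b.1 b.2 X * linePart A c.1 c.2 X with hT
  have h0 : ∑ X, levelOne A X ^ 3 = ∑ a, ∑ b, ∑ c, T a b c := by
    have : ∀ X, levelOne A X = ∑ a : ℙ F (Fin k → F) × ℙ F (Fin k → F), linePart A a.1 a.2 X := by
      intro X
      rw [levelOne, Fintype.sum_prod_type]
    simp_rw [this]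
    exact sum_sum_pow_three fun (a : ℙ F (Fin k → F) × ℙ F (Fin k → F)) X => linePart A a.1 a.2 X
  have h1 : ∑ r, ∑ X, (∑ p, linePart A p r X) ^ 3 =
      ∑ a, ∑ b, ∑ c, if a.2 = b.2 ∧ a.2 = c.2 then T a b c else 0 := by
    rw [Fintype.sum_prod_type_right]
    refine Finset.sum_congr rfl fun r _ => ?_
    rw [sum_sum_pow_three fun p X => linePart A p r X]
    refine Finset.sum_congr rfl fun p _ => ?_
    rw [sum_sum_ite_snd r (T (p, r))]
  have h2 : ∑ p, ∑ X, (∑ r, linePart A p r X) ^ 3 =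
      ∑ a, ∑ b, ∑ c, if a.1 = b.1 ∧ a.1 = c.1 then T a b c else 0 := by
    rw [Fintype.sum_prod_type]
    refine Finset.sum_congr rfl fun p _ => ?_
    rw [sum_sum_pow_three fun r X => linePart A p r X]
    refine Finset.sum_congr rfl fun r _ => ?_
    rw [sum_sum_ite_fst p (T (p, r))]
  have h3 : ∑ p, ∑ r, ∑ X, linePart A p r X ^ 3 =
      ∑ a, ∑ b, ∑ c, if a = b ∧ a = c then T a b c else 0 := by
    rw [← Fintype.sum_prod_type' (f := fun p r => ∑ X, linePart A p r X ^ 3)]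
    refine Finset.sum_congr rfl fun a _ => ?_
    rw [Finset.sum_eq_single a]
    · rw [Finset.sum_eq_single a]
      · simp only [hT, and_self, if_true]
        exact Finset.sum_congr rfl fun X _ => by ring
      · intro c _ hc
        rw [if_neg (fun h => hc h.2.symm)]
      · simp
    · intro b _ hb
      refine Finset.sum_eq_zero fun c _ => ?_
      rw [if_neg (fun h => hb h.1.symm)]
    · simp
  -- Inclusion–exclusion: triples sharing both p and r are counted twice, and triples sharing
  -- neither contribute zero.
  rw [h0, h1, h2, h3, ← Finset.sum_add_distrib, ← Finset.sum_sub_distrib]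
  refine Finset.sum_congr rfl fun a _ => ?_
  rw [← Finset.sum_add_distrib, ← Finset.sum_sub_distrib]
  refine Finset.sum_congr rfl fun b _ => ?_
  rw [← Finset.sum_add_distrib, ← Finset.sum_sub_distrib]
  refine Finset.sum_congr rfl fun c _ => ?_
  by_cases hp : a.1 = b.1 ∧ a.1 = c.1 <;> by_cases hr : a.2 = b.2 ∧ a.2 = c.2
  · rw [if_pos hp, if_pos hr, if_pos ⟨Prod.ext hp.1 hr.1, Prod.ext hp.2 hr.2⟩]
    ring
  · rw [if_pos hp, if_neg hr, if_neg (by rintro ⟨rfl, rfl⟩; exact hr ⟨rfl, rfl⟩)]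
    ring
  · rw [if_neg hp, if_pos hr, if_neg (by rintro ⟨rfl, rfl⟩; exact hp ⟨rfl, rfl⟩)]
    ring
  · rw [if_neg hp, if_neg hr, if_neg (by rintro ⟨rfl, rfl⟩; exact hp ⟨rfl, rfl⟩)]
    rw [add_zero, sub_zero]
    exact sum_linePart_mul_mul A hp hr

end LineParts

/-! ### Rank-one Fourier weight and the level-one inequality -/

section LevelOne

variable {F : Type*} [Field F] [Fintype F] [DecidableEq F] {k : ℕ}

theorem exists_lineForm_eq_one (p r : ℙ F (Fin k → F)) :
    ∃ Z : Matrix (Fin k) (Fin k) F, lineForm p r Z = 1 := by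
  obtain ⟨x, hx⟩ := exists_dotProduct_rep_one p
  obtain ⟨y, hy⟩ := exists_dotProduct_rep_one r
  exact ⟨vecMulVec x y, by rw [lineForm_vecMulVec, hx, hy, one_mul]⟩

theorem sum_comp_lineForm (p r : ℙ F (Fin k → F)) (h : F → ℝ) :
    (Fintype.card F : ℝ) * ∑ X : Matrix (Fin k) (Fin k) F, h (lineForm p r X) =
      (Fintype.card F : ℝ) ^ (k ^ 2) * ∑ t, h t := by
  obtain ⟨Z, hZ⟩ := exists_lineForm_eq_one p r
  have h1 : ∀ t : F, ∑ X : Matrix (Fin k) (Fin k) F, h (lineForm p r X + t) =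
      ∑ X : Matrix (Fin k) (Fin k) F, h (lineForm p r X) := by
    intro t
    rw [← Equiv.sum_comp (Equiv.addRight (t • Z)) (fun X => h (lineForm p r X))]
    refine Finset.sum_congr rfl fun X _ => ?_
    simp [lineForm_add_smul, hZ]
  have h2 : ∑ t : F, ∑ X : Matrix (Fin k) (Fin k) F, h (lineForm p r X + t) =
      (Fintype.card F : ℝ) * ∑ X : Matrix (Fin k) (Fin k) F, h (lineForm p r X) := by
    rw [Finset.sum_congr rfl fun t _ => h1 t]
    simp
  rw [← h2, Finset.sum_comm]
  have h3 : ∀ X : Matrix (Fin k) (Fin k) F, ∑ t, h (lineForm p r X + t) = ∑ t, h t := fun X =>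
    Equiv.sum_comp (Equiv.addLeft (lineForm p r X)) h
  rw [Finset.sum_congr rfl fun X _ => h3 X, Finset.sum_const, Finset.card_univ, card_matrix_sq]
  simp

/-- The line part is n times the orthogonal projection of the indicator of A to mean-zero functions
of pᵀ X r, so its squared norm is n times its inner product with that indicator. -/
theorem sum_linePart_sq (A : Finset (Matrix (Fin k) (Fin k) F)) (p r : ℙ F (Fin k → F)) :
    ∑ X, linePart A p r X ^ 2 =
      (Fintype.card F : ℝ) ^ (k ^ 2) * ∑ X ∈ A, linePart A p r X := by
  have hq : (Fintype.card F : ℝ) ≠ 0 := by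
    have := two_le_card (F := F)
    linarith
  set M : F → ℝ := fun t =>
    ∑ Y ∈ A, ((Fintype.card F : ℝ) * (if lineForm p r Y = t then 1 else 0) - 1) with hM
  have hM0 : ∑ t, M t = 0 := by
    rw [hM, Finset.sum_comm]
    refine Finset.sum_eq_zero fun Y _ => ?_
    have := sum_line_shift (lineForm p r Y) 0
    simp only [zero_add] at this
    exact this
  have hX : ∀ X, linePart A p r X ^ 2 = ∑ Y ∈ A, M (lineForm p r X) *
      ((Fintype.card F : ℝ) * (if lineForm p r Y = lineForm p r X then 1 else 0) - 1) := by
    intro X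
    rw [← Finset.mul_sum, sq]
    rfl
  simp_rw [hX]
  rw [Finset.sum_comm, Finset.mul_sum]
  refine Finset.sum_congr rfl fun Y _ => ?_
  apply mul_left_cancel₀ hq
  rw [sum_comp_lineForm p r (fun t => M t *
    ((Fintype.card F : ℝ) * (if lineForm p r Y = t then 1 else 0) - 1))]
  have : ∑ t, M t * ((Fintype.card F : ℝ) * (if lineForm p r Y = t then 1 else 0) - 1) =
      (Fintype.card F : ℝ) * linePart A p r Y := by
    simp only [mul_sub, Finset.sum_sub_distrib, mul_one, hM0, sub_zero]
    have : ∀ t, M t * ((Fintype.card F : ℝ) * (if lineForm p r Y = t then 1 else 0)) =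
        if lineForm p r Y = t then (Fintype.card F : ℝ) * M t else 0 := by
      intro t
      split_ifs <;> ring
    simp_rw [this]
    rw [Finset.sum_ite_eq]
    simp [hM, linePart]
  rw [this]
  ring

theorem sum_levelOne_sq_eq (A : Finset (Matrix (Fin k) (Fin k) F)) :
    ∑ X, levelOne A X ^ 2 = (Fintype.card F : ℝ) ^ (k ^ 2) * ∑ X ∈ A, levelOne A X := by
  rw [sum_levelOne_sq]
  simp_rw [sum_linePart_sq, levelOne, ← Finset.mul_sum]
  congr 1
  rw [Finset.sum_comm (s := A)]
  refine Finset.sum_congr rfl fun p _ => ?_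
  rw [Finset.sum_comm (s := A)]

/-- This parametrisation groups the rank-one frequencies by lines through 0, one for each pair (p,
r). -/
theorem bijective_rank_one : Function.Bijective
    (fun x : (ℙ F (Fin k → F) × ℙ F (Fin k → F)) × Fˣ =>
      (⟨(x.2 : F) • vecMulVec x.1.1.rep x.1.2.rep, by
        have hle := Matrix.rank_vecMulVec_le ((x.2 : F) • x.1.1.rep) x.1.2.rep
        rw [Matrix.smul_vecMulVec] at hle
        have hne : ((x.2 : F) • vecMulVec x.1.1.rep x.1.2.rep).rank ≠ 0 := by
          rw [Ne, rank_eq_zero_iff, smul_eq_zero, not_or]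
          refine ⟨x.2.ne_zero, fun h => ?_⟩
          rw [Matrix.vecMulVec_eq_zero] at h
          exact h.elim x.1.1.rep_nonzero x.1.2.rep_nonzero
        omega⟩ : {R : Matrix (Fin k) (Fin k) F // R.rank = 1})) := by
  constructor
  · rintro ⟨⟨p, r⟩, t⟩ ⟨⟨p', r'⟩, t'⟩ h
    have h' : (t : F) • vecMulVec p.rep r.rep = (t' : F) • vecMulVec p'.rep r'.rep :=
      congrArg Subtype.val h
    have hp : p = p' := by
      by_contra hne
      obtain ⟨x, hx, hx'⟩ := exists_dotProduct_rep hne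
      have := congrArg (fun R => x ᵥ* R) h'
      simp only [Matrix.vecMul_smul, Matrix.vecMul_vecMulVec, dotProduct_comm x, hx, hx',
        one_smul, zero_smul, smul_zero] at this
      exact smul_ne_zero t.ne_zero r.rep_nonzero this
    have hr : r = r' := by
      by_contra hne
      obtain ⟨x, hx, hx'⟩ := exists_dotProduct_rep hne
      have := congrArg (fun R => R *ᵥ x) h'
      simp only [Matrix.smul_mulVec, Matrix.vecMulVec_mulVec, hx, hx'] at this
      have h3 : (t : F) • p.rep = 0 := by simpa using this
      exact smul_ne_zero t.ne_zero p.rep_nonzero h3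
    subst hp hr
    have hv : vecMulVec p.rep r.rep ≠ 0 := fun h0 =>
      (Matrix.vecMulVec_eq_zero.1 h0).elim p.rep_nonzero r.rep_nonzero
    have : (t : F) = t' := smul_left_injective F hv h'
    rw [Units.ext this]
  · rintro ⟨R, hR⟩
    rw [Matrix.rank_eq_finrank_span_cols] at hR
    obtain ⟨v, hv0, hv⟩ := finrank_eq_one_iff'.1 hR
    have hcol : ∀ j, ∃ c : F, c • (v : Fin k → F) = R.col j := fun j => by
      obtain ⟨c, hc⟩ := hv ⟨R.col j, Submodule.subset_span ⟨j, rfl⟩⟩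
      exact ⟨c, congrArg Subtype.val hc⟩
    choose u hu using hcol
    have hRuv : R = vecMulVec (v : Fin k → F) u := by
      ext i j
      have := congrFun (hu j) i
      simp only [Pi.smul_apply, smul_eq_mul] at this
      rw [vecMulVec_apply, mul_comm, this]
      rfl
    have hv1 : (v : Fin k → F) ≠ 0 := fun h => hv0 (Subtype.ext h)
    have hu0 : u ≠ 0 := by
      rintro rfl
      rw [vecMulVec_zero] at hRuv
      rw [← Matrix.rank_eq_finrank_span_cols, hRuv, Matrix.rank_zero] at hR
      exact zero_ne_one hR
    obtain ⟨⟨p, s⟩, hps⟩ := (bijective_smul_rep (F := F) (Fin k → F)).2 ⟨v, hv1⟩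
    obtain ⟨⟨r, s'⟩, hrs⟩ := (bijective_smul_rep (F := F) (Fin k → F)).2 ⟨u, hu0⟩
    refine ⟨⟨⟨p, r⟩, s * s'⟩, Subtype.ext ?_⟩
    have e1 : (s : F) • p.rep = v := congrArg Subtype.val hps
    have e2 : (s' : F) • r.rep = u := congrArg Subtype.val hrs
    simp only
    rw [hRuv, ← e1, ← e2]
    simp [Matrix.smul_vecMulVec, Matrix.vecMulVec_smul, mul_smul, smul_comm (s : F)]

theorem sum_units_baseChar (a : F) :
    ∑ t : Fˣ, baseChar F ((t : F) * a) = (Fintype.card F : ℂ) * (if a = 0 then 1 else 0) - 1 := by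
  have h := sum_baseChar_linear (LinearMap.toSpanSingleton F F a)
  simp only [LinearMap.toSpanSingleton_apply, smul_eq_mul,
    LinearMap.toSpanSingleton_eq_zero_iff] at h
  have h2 : ∑ t : F, baseChar F (t * a) = ∑ t : Fˣ, baseChar F ((t : F) * a) + 1 := by
    rw [← Finset.add_sum_erase _ _ (Finset.mem_univ (0 : F)), add_comm]
    congr 1
    · refine (Finset.sum_bij' (fun (t : Fˣ) _ => (t : F))
        (fun t ht => Units.mk0 t (Finset.ne_of_mem_erase ht)) ?_ ?_ ?_ ?_ ?_).symm
      · intro t _; simp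
      · intro t _; simp
      · intro t _; simp
      · intro t _; simp
      · intro t _; rfl
    · simp
  rw [eq_sub_iff_add_eq, ← h2, h]
  simp

/-- For fixed p and r, summing over the non-zero multiples of p rᵀ turns the character into q·[equal
forms] - 1, the kernel of the line part. -/
theorem rankOneWeight_eq (A : Finset (Matrix (Fin k) (Fin k) F)) :
    rankOneWeight A = ∑ X ∈ A, levelOne A X := by
  have h0 : rankOneWeight A = ∑ x : (ℙ F (Fin k → F) × ℙ F (Fin k → F)) × Fˣ,
      Complex.normSq (setHat A ((x.2 : F) • vecMulVec x.1.1.rep x.1.2.rep)) := by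
    rw [rankOneWeight, Finset.sum_subtype _ (p := fun R => R.rank = 1) (by simp)]
    exact (Fintype.sum_bijective _ bijective_rank_one _ _ (fun _ => rfl)).symm
  have h1 : ∀ p r : ℙ F (Fin k → F),
      ∑ t : Fˣ, Complex.normSq (setHat A ((t : F) • vecMulVec p.rep r.rep)) =
        ∑ X ∈ A, linePart A p r X := by
    intro p r
    have hC : ∑ t : Fˣ, (Complex.normSq (setHat A ((t : F) • vecMulVec p.rep r.rep)) : ℂ) =
        ∑ X ∈ A, ∑ Y ∈ A,
          ((Fintype.card F : ℂ) * (if lineForm p r Y = lineForm p r X then 1 else 0) - 1) := by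
      have : ∀ t : Fˣ, (Complex.normSq (setHat A ((t : F) • vecMulVec p.rep r.rep)) : ℂ) =
          ∑ X ∈ A, ∑ Y ∈ A, baseChar F ((t : F) * lineForm p r (Y - X)) := by
        intro t
        rw [← Complex.mul_conj, setHat, map_sum, Finset.sum_mul_sum, Finset.sum_comm]
        refine Finset.sum_congr rfl fun X _ => Finset.sum_congr rfl fun Y _ => ?_
        rw [← matChar_sub, matChar, ← Matrix.smul_vecMulVec, tracePairing_vecMulVec, lineForm,
          smul_dotProduct, smul_eq_mul]
      simp_rw [this]
      rw [Finset.sum_comm]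
      refine Finset.sum_congr rfl fun X _ => ?_
      rw [Finset.sum_comm]
      refine Finset.sum_congr rfl fun Y _ => ?_
      rw [sum_units_baseChar, lineForm_sub]
      simp only [sub_eq_zero]
    have : ((∑ t : Fˣ, Complex.normSq (setHat A ((t : F) • vecMulVec p.rep r.rep)) : ℝ) : ℂ) =
        ((∑ X ∈ A, linePart A p r X : ℝ) : ℂ) := by
      simp only [linePart]
      push_cast
      simp only [apply_ite ((↑) : ℝ → ℂ), Complex.ofReal_one, Complex.ofReal_zero]
      exact hC
    exact_mod_cast this
  rw [h0, Fintype.sum_prod_type, Fintype.sum_prod_type]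
  simp_rw [h1, levelOne]
  rw [Finset.sum_comm (s := A)]
  refine Finset.sum_congr rfl fun p _ => ?_
  rw [Finset.sum_comm (s := A)]

/-- In each of the two grouped cubes one factor is at most Q D - |A|, and the subtracted cubes of
single line parts cost at most |A|. The total 2 (Q D - |A|) + |A| is below 2 Q D. -/
theorem sum_levelOne_pow_three_le (A : Finset (Matrix (Fin k) (Fin k) F)) (D : ℝ)
    (hD : ∀ (r : ℙ F (Fin k → F)) (x : Fin k → F),
      ((A.filter fun Y => Y *ᵥ r.rep = x).card : ℝ) ≤ D)
    (hD' : ∀ (p : ℙ F (Fin k → F)) (x : Fin k → F),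
      ((A.filter fun Y => p.rep ᵥ* Y = x).card : ℝ) ≤ D) :
    ∑ X, levelOne A X ^ 3 ≤
      2 * (Fintype.card F : ℝ) ^ k * D * ∑ X, levelOne A X ^ 2 := by
  have hQ : 0 ≤ (Fintype.card F : ℝ) ^ k := by positivity
  have e1 : ∑ r, ∑ X, (∑ p, linePart A p r X) ^ 3 ≤
      ((Fintype.card F : ℝ) ^ k * D - A.card) * ∑ X, levelOne A X ^ 2 := by
    have hcomm : ∑ X, levelOne A X ^ 2 = ∑ r, ∑ p, ∑ X, linePart A p r X ^ 2 := by
      rw [sum_levelOne_sq, Finset.sum_comm]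
    rw [hcomm, Finset.mul_sum]
    refine Finset.sum_le_sum fun r _ => ?_
    rw [← sum_left_sq, Finset.mul_sum]
    refine Finset.sum_le_sum fun X _ => ?_
    rw [pow_succ' _ 2]
    refine mul_le_mul_of_nonneg_right ?_ (sq_nonneg _)
    rw [sum_linePart_left]
    have := mul_le_mul_of_nonneg_left (hD r (X *ᵥ r.rep)) hQ
    linarith
  have e2 : ∑ p, ∑ X, (∑ r, linePart A p r X) ^ 3 ≤
      ((Fintype.card F : ℝ) ^ k * D - A.card) * ∑ X, levelOne A X ^ 2 := by
    rw [sum_levelOne_sq, Finset.mul_sum]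
    refine Finset.sum_le_sum fun p _ => ?_
    rw [← sum_right_sq, Finset.mul_sum]
    refine Finset.sum_le_sum fun X _ => ?_
    rw [pow_succ' _ 2]
    refine mul_le_mul_of_nonneg_right ?_ (sq_nonneg _)
    rw [sum_linePart_right]
    have := mul_le_mul_of_nonneg_left (hD' p (p.rep ᵥ* X)) hQ
    linarith
  have e3 : -(A.card : ℝ) * ∑ X, levelOne A X ^ 2 ≤ ∑ p, ∑ r, ∑ X, linePart A p r X ^ 3 := by
    rw [sum_levelOne_sq, Finset.mul_sum]
    refine Finset.sum_le_sum fun p _ => ?_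
    rw [Finset.mul_sum]
    refine Finset.sum_le_sum fun r _ => ?_
    rw [Finset.mul_sum]
    refine Finset.sum_le_sum fun X _ => ?_
    rw [pow_succ' _ 2]
    exact mul_le_mul_of_nonneg_right (neg_card_le_linePart A p r X) (sq_nonneg _)
  have hnn : 0 ≤ (A.card : ℝ) * ∑ X, levelOne A X ^ 2 :=
    mul_nonneg (Nat.cast_nonneg _) (Finset.sum_nonneg fun _ _ => sq_nonneg _)
  rw [sum_levelOne_pow_three]
  linarith

/-- Sets of matrices with singular differences: an upper bound for the average of the level one
part in terms of the largest number of members sharing a vector image or covector image. -/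
theorem levelOne_average_le (A : Finset (Matrix (Fin k) (Fin k) F)) (D : ℝ)
    (hD : ∀ (r : ℙ F (Fin k → F)) (x : Fin k → F),
      ((A.filter fun Y => Y *ᵥ r.rep = x).card : ℝ) ≤ D)
    (hD' : ∀ (p : ℙ F (Fin k → F)) (x : Fin k → F),
      ((A.filter fun Y => p.rep ᵥ* Y = x).card : ℝ) ≤ D)
    (hW : 0 < ∑ X ∈ A, levelOne A X) :
    (∑ X ∈ A, levelOne A X) * (∑ X ∈ A, levelOne A X +
      Fintype.card (ℙ F (Fin k → F)) * (A.card : ℝ) ^ 2) ≤ (A.card : ℝ) ^ 2 *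
      (Fintype.card F : ℝ) ^ (k ^ 2) * (2 * (Fintype.card F : ℝ) ^ k * D +
        Fintype.card (ℙ F (Fin k → F)) * A.card) := by
  set n : ℝ := (Fintype.card F : ℝ) ^ (k ^ 2)
  set Q : ℝ := (Fintype.card F : ℝ) ^ k
  set s : ℝ := Fintype.card (ℙ F (Fin k → F)) * (A.card : ℝ) with hs
  set W := ∑ X ∈ A, levelOne A X with hWdef
  have hsq : ∑ X, levelOne A X ^ 2 = n * W := sum_levelOne_sq_eq A
  have hcube : ∑ X, levelOne A X ^ 3 ≤ 2 * Q * D * (n * W) := by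
    rw [← hsq]
    exact sum_levelOne_pow_three_le A D hD hD'
  have ha : 0 < (A.card : ℝ) := by
    have : A.Nonempty := Finset.nonempty_of_sum_ne_zero hW.ne'
    exact_mod_cast this.card_pos
  obtain ⟨Δ, hWΔ, hΔ0⟩ : ∃ Δ : ℝ, W = A.card * Δ ∧ 0 < Δ :=
    ⟨W / A.card, (mul_div_cancel₀ W ha.ne').symm, div_pos hW ha⟩
  have hs0 : 0 ≤ s := by positivity
  -- The shift by s makes every summand non-negative, so the sum over A is at most the sum over all
  -- matrices.
  have hlow : (A.card : ℝ) * (Δ ^ 2 * (Δ + s)) ≤ ∑ X, levelOne A X ^ 2 * (levelOne A X + s) := by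
    have e1 : ∑ X ∈ A, levelOne A X ^ 2 * (levelOne A X + s) ≤
        ∑ X, levelOne A X ^ 2 * (levelOne A X + s) := by
      refine Finset.sum_le_sum_of_subset_of_nonneg (Finset.subset_univ _) fun X _ _ => ?_
      have := levelOne_ge A X
      exact mul_nonneg (sq_nonneg _) (by linarith)
    -- Tangent line of t^2 (t + s) at Δ: the remainder is (t - Δ)^2 (t + 2Δ + s). The linear term
    -- cancels because Δ is the average over A.
    have e2 : ∑ X ∈ A, (Δ ^ 2 * (Δ + s) + (3 * Δ ^ 2 + 2 * s * Δ) * (levelOne A X - Δ)) ≤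
        ∑ X ∈ A, levelOne A X ^ 2 * (levelOne A X + s) := by
      refine Finset.sum_le_sum fun X _ => ?_
      have h1 := levelOne_ge A X
      have h2 : 0 ≤ (levelOne A X - Δ) ^ 2 * (levelOne A X + 2 * Δ + s) :=
        mul_nonneg (sq_nonneg _) (by linarith)
      nlinarith
    have e3 : ∑ X ∈ A, (levelOne A X - Δ) = 0 := by
      rw [Finset.sum_sub_distrib, ← hWdef, Finset.sum_const, nsmul_eq_mul, hWΔ, sub_self]
    rw [Finset.sum_add_distrib, ← Finset.mul_sum (f := fun X => levelOne A X - Δ), e3, mul_zero,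
      add_zero, Finset.sum_const, nsmul_eq_mul] at e2
    exact e2.trans e1
  have hup : ∑ X, levelOne A X ^ 2 * (levelOne A X + s) =
      ∑ X, levelOne A X ^ 3 + s * (n * W) := by
    rw [← hsq, Finset.mul_sum, ← Finset.sum_add_distrib]
    exact Finset.sum_congr rfl fun X _ => by ring
  rw [hup, hWΔ] at hlow
  rw [hWΔ] at hcube
  have hmain : Δ * (Δ + s) ≤ n * (2 * Q * D + s) := by
    have : (A.card * Δ) * (Δ * (Δ + s)) ≤ (A.card * Δ) * (n * (2 * Q * D + s)) := by linarith
    exact le_of_mul_le_mul_left this (mul_pos ha hΔ0)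
  have := mul_le_mul_of_nonneg_left hmain (sq_nonneg (A.card : ℝ))
  rw [hWΔ]
  refine le_trans (le_of_eq ?_) (this.trans (le_of_eq ?_))
  · rw [hs]; ring
  · ring

end LevelOne

/-! ### Contradiction for a dense set of matrices with singular differences -/

section LevelInequality

/-- With ε = 0 the hypotheses would give c q ≤ 1, against c q (q - 1) ≥ q + 5/2. The argument checks
that a perturbation of size ε ≤ 1 / (q^4 - 1) cannot close this gap. -/
theorem level_inequality_false {q ε c δ : ℝ} (hq : 3 ≤ q) (hε0 : 0 ≤ ε)
    (hε : ε * (q ^ 4 - 1) ≤ 1) (hc : q + 5 / 2 ≤ c * (q * (q - 1))) (hδ : c - ε ≤ δ)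
    (h : δ * (δ + c / (q - 1)) ≤ c / (q - 1) + 12 / 5 * (ε / c)) : False := by
  have hq1 : 0 < q - 1 := by linarith
  have hc1 : 1 ≤ c * (q - 1) := by
    have : q * 1 ≤ q * (c * (q - 1)) := by nlinarith
    exact le_of_mul_le_mul_left this (by linarith)
  have hc0 : 0 < c := by
    by_contra hneg
    nlinarith
  have hq4 : (q ^ 4 - 1) = (q - 1) * ((q + 1) * (q ^ 2 + 1)) := by ring
  have hεc : ε ≤ c := by
    have h1 : (q - 1) * ε ≤ 1 := by
      have : 1 ≤ (q + 1) * (q ^ 2 + 1) := by nlinarith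
      have h2 : (q - 1) * ε ≤ (q - 1) * ε * ((q + 1) * (q ^ 2 + 1)) :=
        le_mul_of_one_le_right (by positivity) this
      rw [hq4] at hε
      linarith
    have : (q - 1) * ε ≤ (q - 1) * c := by linarith
    exact le_of_mul_le_mul_left this hq1
  have hmul : (c - ε) * (c - ε + c / (q - 1)) ≤ δ * (δ + c / (q - 1)) := by
    have : 0 ≤ c / (q - 1) := by positivity
    exact mul_le_mul hδ (by linarith) (by linarith) (by linarith)
  have h2 := mul_le_mul_of_nonneg_right (hmul.trans h) (by positivity : 0 ≤ (q - 1) * c)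
  have e1 : (c - ε) * (c - ε + c / (q - 1)) * ((q - 1) * c) =
      c * (c - ε) * ((c - ε) * (q - 1) + c) := by
    field_simp
  have e2 : (c / (q - 1) + 12 / 5 * (ε / c)) * ((q - 1) * c) =
      c ^ 2 + 12 / 5 * ε * (q - 1) := by
    field_simp
  rw [e1, e2] at h2
  have h3 : c ^ 2 * (c * q - 1) ≤ ε * ((2 * q - 1) * c ^ 2 + 12 / 5 * (q - 1)) := by
    have : 0 ≤ c * ε ^ 2 * (q - 1) := by positivity
    nlinarith
  -- The gap is (q + 5/2) - (q - 1) = 7/2. The error terms will total at most 3 ε (q^4 - 1) ≤ 3.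
  have h4 : 7 / 2 ≤ (c * q - 1) * (q - 1) := by nlinarith
  have hc2 : 1 ≤ c ^ 2 * (q - 1) ^ 2 := by
    have := mul_le_mul hc1 hc1 zero_le_one (by linarith)
    nlinarith
  have h5 := mul_le_mul_of_nonneg_right h3 (by positivity : 0 ≤ (q - 1) ^ 2)
  -- everything in terms of `u = c ^ 2`
  have h6 : c ^ 2 * (q - 1) * (7 / 2) ≤
      ε * (q - 1) ^ 2 * ((2 * q - 1) * c ^ 2 + 12 / 5 * (q - 1)) := by
    have : c ^ 2 * (q - 1) * (7 / 2) ≤ c ^ 2 * (q - 1) * ((c * q - 1) * (q - 1)) :=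
      mul_le_mul_of_nonneg_left h4 (by positivity)
    nlinarith
  have h7 : (2 * q - 1) * c ^ 2 + 12 / 5 * (q - 1) ≤
      c ^ 2 * ((2 * q - 1) + 12 / 5 * (q - 1) ^ 3) := by
    have : 12 / 5 * (q - 1) * 1 ≤ 12 / 5 * (q - 1) * (c ^ 2 * (q - 1) ^ 2) :=
      mul_le_mul_of_nonneg_left hc2 (by positivity)
    nlinarith
  have h8 : c ^ 2 * (q - 1) * (7 / 2) ≤
      c ^ 2 * (q - 1) * (ε * (q - 1) * ((2 * q - 1) + 12 / 5 * (q - 1) ^ 3)) := by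
    refine (h6.trans (mul_le_mul_of_nonneg_left h7 (by positivity : 0 ≤ ε * (q - 1) ^ 2))).trans
      (le_of_eq ?_)
    ring
  have h9 := le_of_mul_le_mul_left h8 (by positivity)
  have h10 : (2 * q - 1) + 12 / 5 * (q - 1) ^ 3 ≤ 3 * ((q + 1) * (q ^ 2 + 1)) := by
    have e : 3 * ((q + 1) * (q ^ 2 + 1)) - ((2 * q - 1) + 12 / 5 * (q - 1) ^ 3) =
        3 / 5 * q ^ 3 + 51 / 5 * (q * (q - 3)) + 122 / 5 * q + 32 / 5 := by ring
    have h1 : 0 ≤ q * (q - 3) := mul_nonneg (by linarith) (by linarith)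
    have h2 : 0 ≤ q ^ 3 := by positivity
    linarith
  have h11 := mul_le_mul_of_nonneg_left h10 (by positivity : 0 ≤ ε * (q - 1))
  have h12 : ε * (q - 1) * (3 * ((q + 1) * (q ^ 2 + 1))) = 3 * (ε * (q ^ 4 - 1)) := by ring
  linarith

theorem epsilon_bounds {q ε c : ℝ} (hq : 3 ≤ q) (hε0 : 0 < ε) (hε : ε * (q ^ 4 - 1) ≤ 1)
    (hc : 1 ≤ c * (q - 1)) : ε < 1 ∧ ε < c ∧ 6 / 5 * ε * (3 * q + 1) ≤ c ^ 2 := by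
  have hq1 : 0 < q - 1 := by linarith
  have hK : 40 ≤ (q + 1) * (q ^ 2 + 1) := by nlinarith
  have hε1 : ε * (q - 1) * 40 ≤ 1 := by
    have h1 : ε * (q - 1) * 40 ≤ ε * (q - 1) * ((q + 1) * (q ^ 2 + 1)) :=
      mul_le_mul_of_nonneg_left hK (by positivity)
    have h2 : ε * (q - 1) * ((q + 1) * (q ^ 2 + 1)) = ε * (q ^ 4 - 1) := by ring
    linarith
  refine ⟨by nlinarith, ?_, ?_⟩
  · have : ε * (q - 1) < c * (q - 1) := by linarith
    exact lt_of_mul_lt_mul_right this hq1.le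
  · have hc2 : 1 ≤ c ^ 2 * (q - 1) ^ 2 := by
      have := mul_le_mul hc hc zero_le_one (by linarith)
      nlinarith
    have h1 : 6 / 5 * (3 * q + 1) * (q - 1) ^ 2 ≤ q ^ 4 - 1 := by
      have e : q ^ 4 - 1 = (q - 1) * ((q + 1) * (q ^ 2 + 1)) := by ring
      have e' : 6 / 5 * (3 * q + 1) * (q - 1) ^ 2 = (q - 1) * (6 / 5 * (3 * q + 1) * (q - 1)) := by
        ring
      rw [e, e']
      refine mul_le_mul_of_nonneg_left ?_ hq1.le
      nlinarith [mul_nonneg (by linarith : 0 ≤ q - 3) (sq_nonneg q)]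
    have h2 : 6 / 5 * ε * (3 * q + 1) * (q - 1) ^ 2 ≤ c ^ 2 * (q - 1) ^ 2 := by
      have := mul_le_mul_of_nonneg_left h1 hε0.le
      have e : 6 / 5 * ε * (3 * q + 1) * (q - 1) ^ 2 = ε * (6 / 5 * (3 * q + 1) * (q - 1) ^ 2) := by
        ring
      linarith
    exact le_of_mul_le_mul_right h2 (by positivity)

/-- If `d (a - d)` is small, then `d` is either small or close to `a`. -/
theorem le_of_mul_sub_le {q a d E : ℝ} (hq : 3 ≤ q) (ha : 0 < a) (hE0 : 0 < E)
    (hE : 6 / 5 * E * (3 * q + 1) ≤ a ^ 2) (hd : d * (a - d) ≤ E)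
    (hda : d * (3 * q + 1) ≤ a * (3 * q)) : d ≤ 6 / 5 * (E / a) := by
  by_contra! hlt
  obtain ⟨e, he⟩ : ∃ e, E = e * a := ⟨E / a, by field_simp⟩
  rw [he, mul_div_assoc, div_self ha.ne', mul_one] at hlt
  subst he
  have he0 : 0 < e := by
    by_contra hneg
    nlinarith
  have h1 : 6 / 5 * e * (3 * q + 1) ≤ a := by
    have : a * (6 / 5 * e * (3 * q + 1)) ≤ a * a := by nlinarith
    exact le_of_mul_le_mul_left this ha
  -- On the interval from 6e/5 to 3q a / (3q + 1) the concave function d (a - d) exceeds E = e a.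
  -- Both endpoints are tested through 6/5 e (3q + 1) ≤ a, and the constant 6/5 is the slack this
  -- needs.
  have h2 : 0 ≤ (d - 6 / 5 * e) * (a * (3 * q) - d * (3 * q + 1)) :=
    mul_nonneg (by linarith) (by linarith)
  have h3 : 0 ≤ (d - 6 / 5 * e) * (a - 6 / 5 * e * (3 * q + 1)) :=
    mul_nonneg (by linarith) (by linarith)
  have h4 : d * (a - d) * (3 * q + 1) ≤ e * a * (3 * q + 1) :=
    mul_le_mul_of_nonneg_right hd (by linarith)
  nlinarith [mul_pos he0 ha, mul_nonneg he0.le (sub_nonneg.2 h1), mul_pos he0 he0]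

variable {F : Type*} [Field F] [Fintype F] [DecidableEq F] {k : ℕ}

/-- Right multiplication by an invertible matrix with column u turns Y u into a column and keeps
differences singular, so the cross bound applies to the members with Y u = x and the rest. -/
theorem card_mulVec_mul_card_le (hk : 2 ≤ k) (A : Finset (Matrix (Fin k) (Fin k) F))
    (h : ∀ X ∈ A, ∀ Y ∈ A, (X - Y).det = 0) {u : Fin k → F} (hu : u ≠ 0) (x : Fin k → F) :
    ((A.filter fun Y => Y *ᵥ u = x).card : ℝ) *
      (A.card - (A.filter fun Y => Y *ᵥ u = x).card) *
      (((Fintype.card F : ℝ) ^ k) ^ 2 * ((Fintype.card F : ℝ) ^ (k - 1) - 1))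
      ≤ ((Fintype.card F : ℝ) ^ (k ^ 2)) ^ 2 := by
  obtain ⟨j, hj⟩ := Function.ne_iff.1 hu
  set g : Matrix (Fin k) (Fin k) F := (1 : Matrix (Fin k) (Fin k) F).updateCol j u
  have hg : g.det ≠ 0 := by
    have : g.det = u j := by
      rw [← Matrix.cramer_apply, Matrix.cramer_one]
      rfl
    rw [this]
    exact hj
  have hcol : ∀ Y : Matrix (Fin k) (Fin k) F, (Y * g).col j = Y *ᵥ u := by
    intro Y
    ext i
    simp [g, Matrix.col, Matrix.mul_apply, Matrix.mulVec, dotProduct]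
  have hinj : Function.Injective (fun Y : Matrix (Fin k) (Fin k) F => Y * g) := by
    intro X Y hXY
    have := congrArg (fun Z => Z * g⁻¹) hXY
    simpa [Matrix.mul_nonsing_inv_cancel_right _ _ (isUnit_iff_ne_zero.2 hg)] using this
  have key := card_mul_card_le hk ((A.filter fun Y => Y *ᵥ u = x).image fun Y => Y * g)
    ((A.filter fun Y => ¬ Y *ᵥ u = x).image fun Y => Y * g) j (x := x) ?_ ?_ ?_
  · rw [Finset.card_image_of_injective _ hinj, Finset.card_image_of_injective _ hinj] at key
    have hc := Finset.card_filter_add_card_filter_not (s := A) (fun Y => Y *ᵥ u = x)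
    have hc' : ((A.filter fun Y => ¬ Y *ᵥ u = x).card : ℝ) =
        A.card - (A.filter fun Y => Y *ᵥ u = x).card := by
      rw [← hc]; push_cast; ring
    rw [hc'] at key
    exact key
  · intro X hX
    obtain ⟨Y, hY, rfl⟩ := Finset.mem_image.1 hX
    rw [hcol]
    exact (Finset.mem_filter.1 hY).2
  · intro X hX
    obtain ⟨Y, hY, rfl⟩ := Finset.mem_image.1 hX
    rw [hcol]
    exact (Finset.mem_filter.1 hY).2
  · intro X hX Y hY
    obtain ⟨X, hX', rfl⟩ := Finset.mem_image.1 hX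
    obtain ⟨Y, hY', rfl⟩ := Finset.mem_image.1 hY
    rw [← Matrix.sub_mul, Matrix.det_mul, h X (Finset.mem_filter.1 hX').1 Y
      (Finset.mem_filter.1 hY').1, zero_mul]

theorem card_vecMul_mul_card_le (hk : 2 ≤ k) (A : Finset (Matrix (Fin k) (Fin k) F))
    (h : ∀ X ∈ A, ∀ Y ∈ A, (X - Y).det = 0) {u : Fin k → F} (hu : u ≠ 0) (x : Fin k → F) :
    ((A.filter fun Y => u ᵥ* Y = x).card : ℝ) *
      (A.card - (A.filter fun Y => u ᵥ* Y = x).card) *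
      (((Fintype.card F : ℝ) ^ k) ^ 2 * ((Fintype.card F : ℝ) ^ (k - 1) - 1))
      ≤ ((Fintype.card F : ℝ) ^ (k ^ 2)) ^ 2 := by
  have key := card_mulVec_mul_card_le hk (A.image Matrix.transpose) ?_ hu x
  · have hinj : Function.Injective (Matrix.transpose (m := Fin k) (n := Fin k) (α := F)) :=
      Matrix.transpose_injective
    rw [Finset.filter_image, Finset.card_image_of_injective _ hinj,
      Finset.card_image_of_injective _ hinj] at key
    simpa only [Matrix.mulVec_transpose] using key
  · intro X hX Y hY
    obtain ⟨X, hX', rfl⟩ := Finset.mem_image.1 hX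
    obtain ⟨Y, hY', rfl⟩ := Finset.mem_image.1 hY
    rw [← Matrix.transpose_sub, Matrix.det_transpose, h X hX' Y hY']

/-- There is no large set of matrices with singular differences in which each proportion of members
sharing a vector image or a covector image is at most `1 - 1 / (3 q + 1)`. -/
theorem false_of_singular_differences (hk : 5 ≤ k) (hq : 3 ≤ Fintype.card F)
    (A : Finset (Matrix (Fin k) (Fin k) F)) (h : ∀ X ∈ A, ∀ Y ∈ A, (X - Y).det = 0)
    (hA : ((Fintype.card F : ℝ) + 5 / 2) * (Fintype.card F : ℝ) ^ (k ^ 2) ≤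
      A.card * ((Fintype.card F : ℝ) ^ k - 1) * (Fintype.card F * (Fintype.card F - 1)))
    (hB : ∀ u x : Fin k → F, u ≠ 0 →
      ((A.filter fun Y => Y *ᵥ u = x).card : ℝ) * (3 * Fintype.card F + 1) ≤
        A.card * (3 * Fintype.card F))
    (hB' : ∀ u x : Fin k → F, u ≠ 0 →
      ((A.filter fun Y => u ᵥ* Y = x).card : ℝ) * (3 * Fintype.card F + 1) ≤
        A.card * (3 * Fintype.card F)) : False := by
  have hq3 : (3 : ℝ) ≤ Fintype.card F := by exact_mod_cast hq
  have hW := rankOneWeight_ge (by omega) A h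
  have hcard := card_proj_mul (F := F) (k := k)
  have hlev := levelOne_average_le A
  rw [rankOneWeight_eq] at hW
  have hX := fun u x hu => card_mulVec_mul_card_le (by omega : 2 ≤ k) A h (u := u) hu x
  have hX' := fun u x hu => card_vecMul_mul_card_le (by omega : 2 ≤ k) A h (u := u) hu x
  have hQ := one_le_pow_sub_one (two_le_card (F := F)) (m := k) (by omega)
  have hPpos := one_le_pow_sub_one (two_le_card (F := F)) (m := k - 1) (by omega)
  have hP4 : (Fintype.card F : ℝ) ^ 4 - 1 ≤ (Fintype.card F : ℝ) ^ (k - 1) - 1 := by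
    have := pow_le_pow_right₀ (by linarith : (1 : ℝ) ≤ Fintype.card F) (by omega : 4 ≤ k - 1)
    linarith
  have hn : 0 < (Fintype.card F : ℝ) ^ (k ^ 2) := by positivity
  generalize ∑ X ∈ A, levelOne A X = W at *
  generalize (Fintype.card (ℙ F (Fin k → F)) : ℝ) = θ at *
  generalize (Fintype.card F : ℝ) ^ (k ^ 2) = n at *
  generalize (Fintype.card F : ℝ) ^ k = Q at *
  generalize (Fintype.card F : ℝ) ^ (k - 1) - 1 = P at *
  generalize (Fintype.card F : ℝ) = q at *
  have hq1 : 0 < q - 1 := by linarith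
  have ha : 0 < (A.card : ℝ) := by
    rcases (Nat.cast_nonneg (α := ℝ) A.card).eq_or_lt with h0 | h0
    · rw [← h0] at hA
      have : 0 < (q + 5 / 2) * n := by positivity
      linarith
    · exact h0
  have hP : 0 < P := by linarith
  have hQ0 : 0 < Q := by linarith
  -- normalised quantities
  obtain ⟨c, hc⟩ : ∃ c, (A.card : ℝ) * (Q - 1) = c * n := ⟨A.card * (Q - 1) / n, by field_simp⟩
  obtain ⟨ε, hε⟩ : ∃ ε, ε * P = 1 := ⟨1 / P, by field_simp⟩
  obtain ⟨δ, hδ⟩ : ∃ δ, W = δ * (A.card * n) := ⟨W / (A.card * n), by field_simp⟩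
  have hε0 : 0 < ε := by
    by_contra hneg
    nlinarith
  have hcq : q + 5 / 2 ≤ c * (q * (q - 1)) := by
    have : n * (q + 5 / 2) ≤ n * (c * (q * (q - 1))) := by
      rw [hc] at hA
      linarith
    exact le_of_mul_le_mul_left this hn
  have hc0 : 0 < c := by
    by_contra hneg
    have : 0 < q * (q - 1) := by positivity
    nlinarith
  have hc1 : 1 ≤ c * (q - 1) := by
    have : q * 1 ≤ q * (c * (q - 1)) := by nlinarith
    exact le_of_mul_le_mul_left this (by linarith)
  have hεq : ε * (q ^ 4 - 1) ≤ 1 := by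
    exact (mul_le_mul_of_nonneg_left hP4 hε0.le).trans hε.le
  obtain ⟨hε1, hcε, hεc2⟩ := epsilon_bounds hq3 hε0 hεq hc1
  have hPε : 1 / P = ε := by rw [eq_comm, eq_div_iff hP.ne', hε]
  have hδc : c - ε ≤ δ := by
    rw [hPε, hδ] at hW
    have h1 : (A.card * n) * c ≤ (A.card * n) * (δ + ε * (1 - δ)) := by
      have : 0 ≤ ε * (A.card : ℝ) ^ 2 := by positivity
      nlinarith
    have h2 := le_of_mul_le_mul_left h1 (by positivity)
    have h3 : c - ε ≤ δ * (1 - ε) := by linarith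
    have hδ0 : 0 ≤ δ := by
      by_contra hneg
      have := mul_neg_of_neg_of_pos (not_le.1 hneg) (sub_pos.2 hε1)
      linarith
    have := mul_nonneg hδ0 hε0.le
    linarith
  -- the bound for the degrees
  set E : ℝ := n ^ 2 * ε / Q ^ 2 with hE
  have hE0 : 0 < E := by positivity
  have hEa : 6 / 5 * E * (3 * q + 1) ≤ (A.card : ℝ) ^ 2 := by
    have h1 : c * n ≤ A.card * Q := by
      rw [← hc]
      exact mul_le_mul_of_nonneg_left (by linarith) ha.le
    have h2 : (c * n) ^ 2 ≤ (A.card * Q) ^ 2 := pow_le_pow_left₀ (by positivity) h1 2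
    have h3 : 6 / 5 * E * (3 * q + 1) = (6 / 5 * ε * (3 * q + 1)) * n ^ 2 / Q ^ 2 := by
      rw [hE]; ring
    rw [h3, div_le_iff₀ (by positivity)]
    refine (mul_le_mul_of_nonneg_right hεc2 (sq_nonneg n)).trans ?_
    rw [← mul_pow, ← mul_pow]
    exact h2
  have hdeg : ∀ d : ℝ, d * (A.card - d) * (Q ^ 2 * P) ≤ n ^ 2 →
      d * (3 * q + 1) ≤ A.card * (3 * q) → d ≤ 6 / 5 * (E / A.card) := by
    intro d h1 h2
    refine le_of_mul_sub_le hq3 ha hE0 hEa ?_ h2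
    rw [hE, le_div_iff₀ (by positivity)]
    have := mul_le_mul_of_nonneg_right h1 hε0.le
    have e : d * (A.card - d) * (Q ^ 2 * P) * ε = d * (A.card - d) * Q ^ 2 := by
      rw [← mul_one (d * (A.card - d) * Q ^ 2), ← hε]; ring
    linarith
  -- The degree hypotheses rule out the branch where d is close to |A|, so every degree is at most
  -- 6/5 · E / |A|. Doubling 6/5 gives the 12/5 in the final inequality.
  have hlev' := hlev (6 / 5 * (E / A.card))
    (fun r x => hdeg _ (hX _ x r.rep_nonzero) (hB _ x r.rep_nonzero))
    (fun r x => hdeg _ (hX' _ x r.rep_nonzero) (hB' _ x r.rep_nonzero))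
    (by rw [hδ]; exact mul_pos (by linarith) (by positivity))
  have hθ : θ * (A.card : ℝ) = c / (q - 1) * n := by
    rw [div_mul_eq_mul_div, eq_div_iff hq1.ne', ← hc, ← hcard]
    ring
  refine level_inequality_false hq3 hε0.le hεq hcq hδc ?_
  have hEc : Q * E / A.card ≤ n * (ε / c) := by
    rw [div_le_iff₀ ha, hE]
    have h1 : c * n ≤ A.card * Q := by
      rw [← hc]
      exact mul_le_mul_of_nonneg_left (by linarith) ha.le
    have e1 : Q * (n ^ 2 * ε / Q ^ 2) = n ^ 2 * ε / Q := by field_simp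
    have e2 : n * (ε / c) * A.card = n * ε * A.card / c := by ring
    rw [e1, e2, div_le_div_iff₀ hQ0 hc0]
    refine le_trans (le_of_eq ?_) ((mul_le_mul_of_nonneg_left h1
      (by positivity : 0 ≤ n * ε)).trans (le_of_eq ?_)) <;> ring
  rw [hδ] at hlev'
  have hl : δ * (A.card * n) * (δ * (A.card * n) + θ * (A.card : ℝ) ^ 2) =
      ((A.card : ℝ) ^ 2 * n ^ 2) * (δ * (δ + c / (q - 1))) := by
    rw [sq (A.card : ℝ), ← mul_assoc θ, hθ]; ring
  have hr : (A.card : ℝ) ^ 2 * n * (2 * Q * (6 / 5 * (E / A.card)) + θ * A.card) ≤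
      ((A.card : ℝ) ^ 2 * n ^ 2) * (c / (q - 1) + 12 / 5 * (ε / c)) := by
    rw [hθ]
    have := mul_le_mul_of_nonneg_left hEc (by positivity : 0 ≤ (A.card : ℝ) ^ 2 * n * (12 / 5))
    have e : (A.card : ℝ) ^ 2 * n * (12 / 5) * (Q * E / A.card) =
      (A.card : ℝ) ^ 2 * n * (2 * Q * (6 / 5 * (E / A.card))) := by ring
    rw [e] at this
    refine le_trans (le_of_eq (by ring)) ((add_le_add_left this
      ((A.card : ℝ) ^ 2 * n * (c / (q - 1) * n))).trans (le_of_eq (by ring)))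
  rw [hl] at hlev'
  exact le_of_mul_le_mul_left (hlev'.trans hr) (by positivity)

end LevelInequality

/-! ### Estimates for Gaussian coefficients by double counting -/

section Counting

variable {F : Type*} [Field F] [Fintype F] {V : Type*} [AddCommGroup V] [Module F V]
  [FiniteDimensional F V]

theorem finite_of_finiteDimensional (F V : Type*) [Field F] [Fintype F] [AddCommGroup V]
    [Module F V] [FiniteDimensional F V] : Finite V := Module.finite_of_finite F

theorem finite_submodule : Finite (Submodule F V) := by
  have := finite_of_finiteDimensional F V
  exact Finite.of_injective (fun W : Submodule F V => (W : Set V)) SetLike.coe_injective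

theorem card_submodule_finrank (k : ℕ) :
    Nat.card {W : Submodule F V // Module.finrank F W = k} =
      gaussCoeff F (Module.finrank F V) k := by
  have e : V ≃ₗ[F] (Fin (Module.finrank F V) → F) := LinearEquiv.ofFinrankEq _ _ (by simp)
  refine Nat.card_congr ((Submodule.orderIsoMapComap e).toEquiv.subtypeEquiv fun W => ?_)
  rw [← LinearEquiv.finrank_map_eq e W]
  rfl

theorem card_submodule_le_of_le (W : Submodule F V) (k : ℕ) :
    Nat.card {R : Submodule F V // Module.finrank F R = k ∧ R ≤ W} ≤
      gaussCoeff F (Module.finrank F W) k := by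
  have := finite_submodule (F := F) (V := W)
  rw [← card_submodule_finrank]
  refine Nat.card_le_card_of_injective
    (fun R => (⟨R.1.comap W.subtype, 
      (Submodule.comapSubtypeEquivOfLe R.2.2).finrank_eq.trans R.2.1⟩ :
      {R : Submodule F W // Module.finrank F R = k})) ?_
  rintro ⟨R, hR⟩ ⟨S, hS⟩ h
  have h1 : R.comap W.subtype = S.comap W.subtype := congrArg Subtype.val h
  have h2 := congrArg (Submodule.map W.subtype) h1
  rw [Submodule.map_comap_subtype, Submodule.map_comap_subtype, inf_eq_right.2 hR.2,
    inf_eq_right.2 hS.2] at h2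
  exact Subtype.ext h2

theorem finrank_map_mkQ {L W : Submodule F V} (h : L ≤ W) :
    Module.finrank F (W.map L.mkQ) = Module.finrank F W - Module.finrank F L := by
  have h1 := LinearMap.finrank_range_add_finrank_ker (L.mkQ.domRestrict W)
  rw [LinearMap.range_domRestrict, LinearMap.ker_domRestrict, Submodule.ker_mkQ,
    (Submodule.comapSubtypeEquivOfLe h).finrank_eq] at h1
  omega

theorem card_submodule_ge_le (L : Submodule F V) (k : ℕ) :
    Nat.card {W : Submodule F V // Module.finrank F W = k ∧ L ≤ W} ≤
      gaussCoeff F (Module.finrank F V - Module.finrank F L) (k - Module.finrank F L) := by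
  have := finite_submodule (F := F) (V := V ⧸ L)
  have hquot : Module.finrank F (V ⧸ L) = Module.finrank F V - Module.finrank F L := by
    have := Submodule.finrank_quotient_add_finrank L
    omega
  rw [← hquot, ← card_submodule_finrank]
  refine Nat.card_le_card_of_injective
    (fun W => (⟨W.1.map L.mkQ, by
      rw [finrank_map_mkQ W.2.2, W.2.1]⟩ :
      {R : Submodule F (V ⧸ L) // Module.finrank F R = k - Module.finrank F L})) ?_
  rintro ⟨R, hR⟩ ⟨S, hS⟩ h
  have h1 : R.map L.mkQ = S.map L.mkQ := congrArg Subtype.val h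
  have h2 := congrArg (Submodule.comap L.mkQ) h1
  rw [Submodule.comap_map_mkQ, Submodule.comap_map_mkQ, sup_eq_right.2 hR.2,
    sup_eq_right.2 hS.2] at h2
  exact Subtype.ext h2

theorem card_sub_one_le_gaussCoeff_one (k : ℕ) :
    (Fintype.card F : ℝ) ^ k - 1 ≤ (gaussCoeff F k 1 : ℝ) * (Fintype.card F - 1) := by
  classical
  rw [← card_proj_mul]
  have h : Fintype.card (ℙ F (Fin k → F)) ≤ gaussCoeff F k 1 := by
    have := finite_submodule (F := F) (V := Fin k → F)
    rw [← Nat.card_eq_fintype_card, gaussCoeff]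
    refine Nat.card_le_card_of_injective
      (fun p => (⟨p.submodule, p.finrank_submodule⟩ : KSpace F k 1)) ?_
    intro p p' h
    exact Projectivization.submodule_injective (congrArg Subtype.val h)
  have hq := two_le_card (F := F)
  exact mul_le_mul_of_nonneg_right (by exact_mod_cast h) (by linarith)

/-- A k-space together with an ordered basis is determined by a k-tuple of vectors. -/
theorem gaussCoeff_mul_prod_le (n k : ℕ) :
    gaussCoeff F n k * ∏ i : Fin k, (Fintype.card F ^ k - Fintype.card F ^ (i : ℕ)) ≤
      Fintype.card F ^ (n * k) := by
  classical
  have := finite_submodule (F := F) (V := Fin n → F)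
  have : Fintype (KSpace F n k) := Fintype.ofFinite _
  have hc : ∀ W : KSpace F n k, Nat.card {s : Fin k → W.1 // LinearIndependent F s} =
      ∏ i : Fin k, (Fintype.card F ^ k - Fintype.card F ^ (i : ℕ)) := by
    intro W
    rw [card_linearIndependent W.2.ge, W.2]
  have hs : Nat.card (Σ W : KSpace F n k, {s : Fin k → W.1 // LinearIndependent F s}) =
      gaussCoeff F n k * ∏ i : Fin k, (Fintype.card F ^ k - Fintype.card F ^ (i : ℕ)) := by
    rw [Nat.card_sigma]
    simp_rw [hc]
    rw [Finset.sum_const, Finset.card_univ, smul_eq_mul, gaussCoeff, Nat.card_eq_fintype_card]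
  have ht : Nat.card (Fin k → Fin n → F) = Fintype.card F ^ (n * k) := by
    simp [Nat.card_eq_fintype_card, pow_mul]
  rw [← hs, ← ht]
  refine Nat.card_le_card_of_injective (fun x i => ((x.2.1 i : x.1.1) : Fin n → F)) ?_
  rintro ⟨W, s, hs⟩ ⟨W', s', hs'⟩ h
  have hspan : ∀ (W : KSpace F n k) (s : Fin k → W.1), LinearIndependent F s →
      Submodule.span F (Set.range fun i => (s i : Fin n → F)) = W.1 := by
    intro W s hs
    have hs2 : LinearIndependent F (fun i => (s i : Fin n → F)) :=
      hs.map' W.1.subtype W.1.ker_subtype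
    refine Submodule.eq_of_le_of_finrank_eq ?_ ?_
    · rw [Submodule.span_le]
      rintro _ ⟨i, rfl⟩
      exact (s i).2
    · rw [finrank_span_eq_card hs2, Fintype.card_fin, W.2]
  have hW : W = W' := by
    apply Subtype.ext
    rw [← hspan W s hs, ← hspan W' s' hs']
    simp only at h
    rw [h]
  subst hW
  have : s = s' := by
    funext i
    exact Subtype.ext (congrFun h i)
  subst this
  rfl

/-- Count k-spaces with an ordered independent pair inside, the second time choosing the pair first
and then a k-space through its span. -/
theorem gaussCoeff_mul_pairs_le (n k : ℕ) (hk : 2 ≤ k) (hn : 2 ≤ n) :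
    gaussCoeff F n k * ∏ i : Fin 2, (Fintype.card F ^ k - Fintype.card F ^ (i : ℕ)) ≤
      (∏ i : Fin 2, (Fintype.card F ^ n - Fintype.card F ^ (i : ℕ))) *
        gaussCoeff F (n - 2) (k - 2) := by
  classical
  have := finite_submodule (F := F) (V := Fin n → F)
  have : Fintype (KSpace F n k) := Fintype.ofFinite _
  have hc : ∀ W : KSpace F n k, Nat.card {s : Fin 2 → W.1 // LinearIndependent F s} =
      ∏ i : Fin 2, (Fintype.card F ^ k - Fintype.card F ^ (i : ℕ)) := by
    intro W
    rw [card_linearIndependent (by rw [W.2]; exact hk), W.2]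
  have hs : Nat.card (Σ W : KSpace F n k, {s : Fin 2 → W.1 // LinearIndependent F s}) =
      gaussCoeff F n k * ∏ i : Fin 2, (Fintype.card F ^ k - Fintype.card F ^ (i : ℕ)) := by
    rw [Nat.card_sigma]
    simp_rw [hc]
    rw [Finset.sum_const, Finset.card_univ, smul_eq_mul, gaussCoeff, Nat.card_eq_fintype_card]
  have hinj : Nat.card (Σ W : KSpace F n k, {s : Fin 2 → W.1 // LinearIndependent F s}) ≤
      Nat.card (Σ s : {s : Fin 2 → Fin n → F // LinearIndependent F s},
        {W : Submodule F (Fin n → F) // Module.finrank F W = k ∧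
          Submodule.span F (Set.range s.1) ≤ W}) := by
    refine Nat.card_le_card_of_injective (fun x => ⟨⟨fun i => ((x.2.1 i : x.1.1) : Fin n → F),
      x.2.2.map' x.1.1.subtype x.1.1.ker_subtype⟩, ⟨x.1.1, x.1.2, by
        rw [Submodule.span_le]
        rintro _ ⟨i, rfl⟩
        exact (x.2.1 i).2⟩⟩) ?_
    rintro ⟨⟨W, hW⟩, s, hs⟩ ⟨⟨W', hW'⟩, s', hs'⟩ h
    have hWW : W = W' := congrArg (fun y : Σ s : {s : Fin 2 → Fin n → F // LinearIndependent F s},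
        {W : Submodule F (Fin n → F) // Module.finrank F W = k ∧
          Submodule.span F (Set.range s.1) ≤ W} => y.2.1) h
    have h1 : (fun i => (s i : Fin n → F)) = fun i => (s' i : Fin n → F) :=
      congrArg (fun y : Σ s : {s : Fin 2 → Fin n → F // LinearIndependent F s},
        {W : Submodule F (Fin n → F) // Module.finrank F W = k ∧
          Submodule.span F (Set.range s.1) ≤ W} => y.1.1) h
    subst hWW
    have : s = s' := by
      funext i
      exact Subtype.ext (congrFun h1 i)
    subst this
    rfl
  rw [← hs]
  refine hinj.trans ?_
  rw [Nat.card_sigma]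
  have hb : ∀ s ∈ (univ : Finset {s : Fin 2 → Fin n → F // LinearIndependent F s}),
      Nat.card {W : Submodule F (Fin n → F) // Module.finrank F W = k ∧
          Submodule.span F (Set.range s.1) ≤ W} ≤ gaussCoeff F (n - 2) (k - 2) := by
    intro s _
    have := card_submodule_ge_le (Submodule.span F (Set.range s.1)) k
    rwa [finrank_span_eq_card s.2, Fintype.card_fin, Module.finrank_fintype_fun_eq_card,
      Fintype.card_fin] at this
  refine (Finset.sum_le_card_nsmul _ _ _ hb).trans (le_of_eq ?_)
  rw [smul_eq_mul, Finset.card_univ, ← Nat.card_eq_fintype_card,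
    card_linearIndependent (by simpa using hn)]
  simp

end Counting

/-! ### Point and hyperplane degrees of an intersecting family, and averaging over automorphisms -/

section Geometry

variable {F : Type*} [Field F] [Fintype F] {V : Type*} [AddCommGroup V] [Module F V]
  [FiniteDimensional F V]

theorem finrank_sup_eq_two {P R W : Submodule F V} (hP : Module.finrank F P = 1)
    (hR : Module.finrank F R = 1) (hRW : R ≤ W) (hPW : ¬ P ≤ W) :
    Module.finrank F (P ⊔ R : Submodule F V) = 2 := by
  have h := Submodule.finrank_sup_add_finrank_inf_eq P R
  have h0 : P ⊓ R = ⊥ := by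
    by_contra hne
    have h1 : 0 < Module.finrank F (P ⊓ R : Submodule F V) := by
      rw [Nat.pos_iff_ne_zero, Ne, Submodule.finrank_eq_zero]
      exact hne
    have h2 : P ⊓ R = P := Submodule.eq_of_le_of_finrank_le inf_le_left (by omega)
    exact hPW ((inf_eq_left.1 h2).trans hRW)
  rw [h0, finrank_bot] at h
  omega

/-- A member through P meets W₀ in a point R other than P, so it contains the line P ⊔ R. There are
[k, 1] choices of R and at most [dim V - 2, k - 2] members through each line. -/
theorem ncard_point_le {k : ℕ} {S : Set (Submodule F V)} (hk : ∀ W ∈ S, Module.finrank F W = k)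
    (hS : ∀ W ∈ S, ∀ W' ∈ S, W ⊓ W' ≠ ⊥) {P W₀ : Submodule F V}
    (hP : Module.finrank F P = 1) (hW₀ : W₀ ∈ S) (hPW : ¬ P ≤ W₀) :
    {W ∈ S | P ≤ W}.ncard ≤
      gaussCoeff F k 1 * gaussCoeff F (Module.finrank F V - 2) (k - 2) := by
  classical
  have := finite_submodule (F := F) (V := V)
  have := Fintype.ofFinite (Submodule F V)
  have hex : ∀ W : {W // W ∈ S ∧ P ≤ W}, ∃ R : Submodule F V,
      (Module.finrank F R = 1 ∧ R ≤ W₀) ∧ R ≤ W.1 := by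
    rintro ⟨W, hW, -⟩
    obtain ⟨v, hv, hv0⟩ := Submodule.exists_mem_ne_zero_of_ne_bot (hS W hW W₀ hW₀)
    refine ⟨Submodule.span F {v}, ⟨finrank_span_singleton hv0, ?_⟩, ?_⟩
    · simpa using hv.2
    · simpa using hv.1
  choose R hR hRW using hex
  have hinj : Nat.card {W // W ∈ S ∧ P ≤ W} ≤
      Nat.card (Σ R : {R : Submodule F V // Module.finrank F R = 1 ∧ R ≤ W₀},
        {W : Submodule F V // Module.finrank F W = k ∧ P ⊔ R.1 ≤ W}) := by
    refine Nat.card_le_card_of_injective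
      (fun W => ⟨⟨R W, hR W⟩, ⟨W.1, hk _ W.2.1, sup_le W.2.2 (hRW W)⟩⟩) ?_
    intro W W' h
    exact Subtype.ext (congrArg
      (fun y : (Σ R : {R : Submodule F V // Module.finrank F R = 1 ∧ R ≤ W₀},
        {W : Submodule F V // Module.finrank F W = k ∧ P ⊔ R.1 ≤ W}) => y.2.1) h)
  rw [← Nat.card_coe_set_eq]
  refine hinj.trans ?_
  rw [Nat.card_sigma]
  have hb : ∀ R ∈ (univ : Finset {R : Submodule F V // Module.finrank F R = 1 ∧ R ≤ W₀}),
      Nat.card {W : Submodule F V // Module.finrank F W = k ∧ P ⊔ R.1 ≤ W} ≤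
        gaussCoeff F (Module.finrank F V - 2) (k - 2) := by
    intro R _
    have := card_submodule_ge_le (P ⊔ R.1) k
    rwa [finrank_sup_eq_two hP R.2.1 R.2.2 hPW] at this
  refine (Finset.sum_le_card_nsmul _ _ _ hb).trans ?_
  rw [smul_eq_mul, Finset.card_univ, ← Nat.card_eq_fintype_card]
  refine Nat.mul_le_mul_right _ ?_
  have := card_submodule_le_of_le W₀ 1
  rwa [hk _ hW₀] at this

theorem finrank_dualAnnihilator (W : Submodule F V) :
    Module.finrank F W.dualAnnihilator = Module.finrank F V - Module.finrank F W := by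
  have := Subspace.finrank_add_finrank_dualAnnihilator_eq W
  omega

/-- This is the point bound in the dual space. As dim V = 2k, annihilators of k-spaces are k-spaces,
and they meet trivially only if the spaces themselves do. -/
theorem ncard_hyperplane_le {k : ℕ} (hk1 : 1 ≤ k) (hV : Module.finrank F V = 2 * k)
    {S : Set (Submodule F V)}
    (hk : ∀ W ∈ S, Module.finrank F W = k)
    (hS : ∀ W ∈ S, ∀ W' ∈ S, W ⊓ W' ≠ ⊥) {H W₀ : Submodule F V}
    (hH : Module.finrank F H + 1 = 2 * k) (hW₀ : W₀ ∈ S) (hHW : ¬ W₀ ≤ H) :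
    {W ∈ S | W ≤ H}.ncard ≤
      gaussCoeff F k 1 * gaussCoeff F (Module.finrank F V - 2) (k - 2) := by
  have := finite_submodule (F := F) (V := Module.Dual F V)
  have h := ncard_point_le (F := F) (V := Module.Dual F V) (k := k)
    (S := Submodule.dualAnnihilator '' S) (P := H.dualAnnihilator) (W₀ := W₀.dualAnnihilator)
    (by
      rintro _ ⟨W, hW, rfl⟩
      rw [finrank_dualAnnihilator, hk W hW, hV]
      omega)
    (by
      rintro _ ⟨W, hW, rfl⟩ _ ⟨W', hW', rfl⟩ h0
      rw [← Submodule.dualAnnihilator_sup_eq] at h0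
      have h1 := finrank_dualAnnihilator (W ⊔ W')
      rw [h0, finrank_bot, hV] at h1
      have h2 := Submodule.finrank_sup_add_finrank_inf_eq W W'
      rw [hk W hW, hk W' hW'] at h2
      apply hS W hW W' hW'
      rw [← Submodule.finrank_eq_zero (R := F)]
      omega)
    (by rw [finrank_dualAnnihilator]; omega)
    ⟨W₀, hW₀, rfl⟩
    (by rwa [Subspace.dualAnnihilator_le_dualAnnihilator_iff])
  rw [Subspace.dual_finrank_eq] at h
  refine le_trans ?_ h
  refine Set.ncard_le_ncard_of_injOn Submodule.dualAnnihilator ?_ ?_ (Set.toFinite _)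
  · rintro W ⟨hW, hWH⟩
    exact ⟨⟨W, hW, rfl⟩, Submodule.dualAnnihilator_anti hWH⟩
  · intro W _ W' _ hWW
    exact Subspace.dualAnnihilator_inj.1 hWW

theorem exists_map_eq {W W' : Submodule F V} (h : Module.finrank F W = Module.finrank F W') :
    ∃ g : V ≃ₗ[F] V, W.map (g : V →ₗ[F] V) = W' := by
  obtain ⟨C, hC⟩ := W.exists_isCompl
  obtain ⟨C', hC'⟩ := W'.exists_isCompl
  have h1 := Submodule.finrank_add_eq_of_isCompl hC
  have h2 := Submodule.finrank_add_eq_of_isCompl hC'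
  let a : W ≃ₗ[F] W' := LinearEquiv.ofFinrankEq _ _ h
  let b : C ≃ₗ[F] C' := LinearEquiv.ofFinrankEq _ _ (by omega)
  let g : V ≃ₗ[F] V := (Submodule.prodEquivOfIsCompl W C hC).symm.trans
    ((a.prodCongr b).trans (Submodule.prodEquivOfIsCompl W' C' hC'))
  refine ⟨g, Submodule.eq_of_le_of_finrank_eq ?_ ?_⟩
  · rintro _ ⟨w, hw, rfl⟩
    have : g w = a ⟨w, hw⟩ := by
      have h3 : (Submodule.prodEquivOfIsCompl W C hC).symm w = (⟨w, hw⟩, 0) :=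
        Submodule.prodEquivOfIsCompl_symm_apply_left W C hC ⟨w, hw⟩
      simp [g, h3]
    rw [LinearEquiv.coe_coe, this]
    exact (a ⟨w, hw⟩).2
  · rw [LinearEquiv.finrank_map_eq, h]

theorem finite_linearEquiv : Finite (V ≃ₗ[F] V) := by
  have := finite_of_finiteDimensional F V
  exact Finite.of_injective (fun g : V ≃ₗ[F] V => (g : V → V)) DFunLike.coe_injective

/-- The linear group is transitive on k-spaces, so the fibres of g ↦ g U all have the same size. -/
theorem card_map_eq_mul {k : ℕ} {U W : Submodule F V} (hU : Module.finrank F U = k)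
    (hW : Module.finrank F W = k) :
    Nat.card {g : V ≃ₗ[F] V // U.map (g : V →ₗ[F] V) = W} * gaussCoeff F (Module.finrank F V) k =
      Nat.card (V ≃ₗ[F] V) := by
  classical
  have := finite_submodule (F := F) (V := V)
  have := Fintype.ofFinite (Submodule F V)
  have := finite_linearEquiv (F := F) (V := V)
  let f : (V ≃ₗ[F] V) → {W : Submodule F V // Module.finrank F W = k} := fun g =>
    ⟨U.map (g : V →ₗ[F] V), by rw [LinearEquiv.finrank_map_eq, hU]⟩
  have hf : ∀ W' : {W : Submodule F V // Module.finrank F W = k},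
      Nat.card {g // f g = W'} = Nat.card {g : V ≃ₗ[F] V // U.map (g : V →ₗ[F] V) = W} := by
    rintro ⟨W', hW'⟩
    obtain ⟨h, hh⟩ := exists_map_eq (hW'.trans hW.symm)
    obtain ⟨h', hh'⟩ := exists_map_eq (hW.trans hW'.symm)
    refine le_antisymm (Nat.card_le_card_of_injective
      (fun g => ⟨g.1.trans h, ?_⟩) ?_) (Nat.card_le_card_of_injective
      (fun g => ⟨g.1.trans h', ?_⟩) ?_)
    · have h1 : U.map (g.1 : V →ₗ[F] V) = W' := congrArg Subtype.val g.2
      rw [LinearEquiv.coe_trans, Submodule.map_comp, h1, hh]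
    · intro g g' hg
      have h1 : g.1.trans h = g'.1.trans h := congrArg Subtype.val hg
      apply Subtype.ext
      ext v
      exact h.injective (LinearEquiv.congr_fun h1 v)
    · apply Subtype.ext
      change U.map ((g.1.trans h' : V ≃ₗ[F] V) : V →ₗ[F] V) = W'
      rw [LinearEquiv.coe_trans, Submodule.map_comp, g.2, hh']
    · intro g g' hg
      have h1 : g.1.trans h' = g'.1.trans h' := congrArg Subtype.val hg
      apply Subtype.ext
      ext v
      exact h'.injective (LinearEquiv.congr_fun h1 v)
  rw [← Nat.card_congr (Equiv.sigmaFiberEquiv f), Nat.card_sigma]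
  simp_rw [hf]
  rw [Finset.sum_const, smul_eq_mul, mul_comm, Finset.card_univ, ← Nat.card_eq_fintype_card,
    card_submodule_finrank]

/-- A uniformly random automorphism sends each U i to a uniform k-space. Some g therefore does at
least as well as the expectation. -/
theorem exists_linearEquiv_average {ι : Type*} [Fintype ι] [DecidableEq ι] {k : ℕ}
    (S : Set (Submodule F V)) (hS : ∀ W ∈ S, Module.finrank F W = k)
    (U : ι → Submodule F V) (hU : ∀ i, Module.finrank F (U i) = k) :
    ∃ g : V ≃ₗ[F] V, Fintype.card ι * S.ncard ≤
      Nat.card {i // (U i).map (g : V →ₗ[F] V) ∈ S} * gaussCoeff F (Module.finrank F V) k := by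
  classical
  have := finite_submodule (F := F) (V := V)
  have := Fintype.ofFinite (Submodule F V)
  have := finite_linearEquiv (F := F) (V := V)
  have := Fintype.ofFinite (V ≃ₗ[F] V)
  have hcount : ∀ i, (∑ g : V ≃ₗ[F] V, if (U i).map (g : V →ₗ[F] V) ∈ S then 1 else 0) *
      gaussCoeff F (Module.finrank F V) k = S.ncard * Fintype.card (V ≃ₗ[F] V) := by
    intro i
    have h1 : ∀ g : V ≃ₗ[F] V, (if (U i).map (g : V →ₗ[F] V) ∈ S then 1 else 0) =
        ∑ W ∈ S.toFinset, if (U i).map (g : V →ₗ[F] V) = W then 1 else 0 := by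
      intro g
      simp
    simp_rw [h1]
    rw [Finset.sum_comm, Finset.sum_mul]
    have h2 : ∀ W ∈ S.toFinset,
        (∑ g : V ≃ₗ[F] V, if (U i).map (g : V →ₗ[F] V) = W then 1 else 0) *
          gaussCoeff F (Module.finrank F V) k = Fintype.card (V ≃ₗ[F] V) := by
      intro W hW
      rw [← Finset.card_filter, ← Fintype.card_subtype, ← Nat.card_eq_fintype_card,
        ← Nat.card_eq_fintype_card]
      exact card_map_eq_mul (hU i) (hS W (by simpa using hW))
    rw [Finset.sum_congr rfl h2, Finset.sum_const, smul_eq_mul, Set.ncard_eq_toFinset_card']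
  have hsum : ∑ _g : V ≃ₗ[F] V, Fintype.card ι * S.ncard ≤
      ∑ g : V ≃ₗ[F] V,
        Nat.card {i // (U i).map (g : V →ₗ[F] V) ∈ S} * gaussCoeff F (Module.finrank F V) k := by
    refine le_of_eq (Eq.symm ?_)
    rw [← Finset.sum_mul]
    simp_rw [Nat.card_eq_fintype_card, Fintype.card_subtype, Finset.card_filter]
    rw [Finset.sum_comm, Finset.sum_mul, Finset.sum_congr rfl (fun i _ => hcount i)]
    simp only [Finset.sum_const, smul_eq_mul, Finset.card_univ]
    ring
  obtain ⟨g, -, hg⟩ := Finset.exists_le_of_sum_le (univ_nonempty) hsum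
  exact ⟨g, hg⟩

end Geometry

/-! ### Matrices as graphs: the chart of k-spaces -/

section Chart

variable {F : Type*} [Field F] [Fintype F] {k : ℕ}

theorem mulVecLin_graph_injective :
    Function.Injective fun X : Matrix (Fin k) (Fin k) F => X.mulVecLin.graph := by
  intro X X' h
  refine Matrix.ext_of_mulVec_single fun i => ?_
  have h1 : (Pi.single i 1, X *ᵥ Pi.single i 1) ∈ X.mulVecLin.graph := by simp
  have h2 : X.mulVecLin.graph = X'.mulVecLin.graph := h
  rw [h2, LinearMap.mem_graph_iff] at h1
  simpa using h1

theorem finrank_graph (X : Matrix (Fin k) (Fin k) F) :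
    Module.finrank F X.mulVecLin.graph = k := by
  rw [LinearMap.graph_eq_range_prod, LinearMap.finrank_range_of_inj]
  · simp
  · intro a b h
    exact congrArg Prod.fst h

variable {V : Type*} [AddCommGroup V] [Module F V] [FiniteDimensional F V]

theorem map_graph_injective (e : ((Fin k → F) × (Fin k → F)) ≃ₗ[F] V) :
    Function.Injective fun X : Matrix (Fin k) (Fin k) F =>
      X.mulVecLin.graph.map (e : _ →ₗ[F] V) :=
  (Submodule.map_injective_of_injective e.injective).comp mulVecLin_graph_injective

theorem det_sub_eq_zero (e : ((Fin k → F) × (Fin k → F)) ≃ₗ[F] V)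
    {X X' : Matrix (Fin k) (Fin k) F}
    (h : X.mulVecLin.graph.map (e : _ →ₗ[F] V) ⊓ X'.mulVecLin.graph.map (e : _ →ₗ[F] V) ≠ ⊥) :
    (X - X').det = 0 := by
  classical
  rw [← Submodule.map_inf _ e.injective] at h
  obtain ⟨_, ⟨⟨u, w⟩, ⟨h1, h2⟩, rfl⟩, hv0⟩ := Submodule.exists_mem_ne_zero_of_ne_bot h
  have h1 : w = X *ᵥ u := by simpa using h1
  have h2 : w = X' *ᵥ u := by simpa using h2
  refine Matrix.exists_mulVec_eq_zero_iff.1 ⟨u, ?_, ?_⟩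
  · rintro rfl
    apply hv0
    rw [h1, mulVec_zero]
    exact map_zero e
  · rw [sub_mulVec, ← h1, ← h2, sub_self]

/-- The subspace of pairs `(a, b)` with `x ⬝ᵥ a = v ⬝ᵥ b`. -/
def pairHyperplane (v x : Fin k → F) : Submodule F ((Fin k → F) × (Fin k → F)) :=
  LinearMap.ker ((dotProductBilin F F x).comp (LinearMap.fst F _ _) -
    (dotProductBilin F F v).comp (LinearMap.snd F _ _))

theorem mem_pairHyperplane {v x : Fin k → F} {p : (Fin k → F) × (Fin k → F)} :
    p ∈ pairHyperplane v x ↔ x ⬝ᵥ p.1 = v ⬝ᵥ p.2 := by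
  simp [pairHyperplane, sub_eq_zero]

theorem graph_le_pairHyperplane {X : Matrix (Fin k) (Fin k) F} {v x : Fin k → F}
    (h : v ᵥ* X = x) : X.mulVecLin.graph ≤ pairHyperplane v x := by
  rintro ⟨a, b⟩ hab
  have hab : b = X *ᵥ a := by simpa using hab
  rw [mem_pairHyperplane, hab, dotProduct_mulVec, h]

theorem finrank_pairHyperplane {v x : Fin k → F} (hv : v ≠ 0) :
    Module.finrank F (pairHyperplane v x) + 1 = 2 * k := by
  classical
  have h := LinearMap.finrank_range_add_finrank_ker
    ((dotProductBilin F F x).comp (LinearMap.fst F (Fin k → F) (Fin k → F)) -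
    (dotProductBilin F F v).comp (LinearMap.snd F (Fin k → F) (Fin k → F)))
  have hr : LinearMap.range
    ((dotProductBilin F F x).comp (LinearMap.fst F (Fin k → F) (Fin k → F)) -
    (dotProductBilin F F v).comp (LinearMap.snd F (Fin k → F) (Fin k → F))) = ⊤ := by
    apply LinearMap.range_eq_top.2
    apply LinearMap.surjective
    intro h0
    apply hv
    ext i
    have := LinearMap.congr_fun h0 (0, Pi.single i 1)
    simpa using this
  rw [hr, finrank_top] at h
  simp only [Module.finrank_self, Module.finrank_prod, Module.finrank_fintype_fun_eq_card,
    Fintype.card_fin] at h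
  change 1 + Module.finrank F (pairHyperplane v x) = _ at h
  omega

variable [DecidableEq F]

/-- The equation X u = x says that the graph contains the point (u, x). Dually, v X = x puts the
graph inside `pairHyperplane v x`. -/
theorem card_filter_mulVec_le (e : ((Fin k → F) × (Fin k → F)) ≃ₗ[F] V)
    {S : Set (Submodule F V)} {A : Finset (Matrix (Fin k) (Fin k) F)}
    (hA : ∀ X ∈ A, X.mulVecLin.graph.map (e : _ →ₗ[F] V) ∈ S) {d : ℕ}
    (hd : ∀ P : Submodule F V, Module.finrank F P = 1 → {W ∈ S | P ≤ W}.ncard ≤ d)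
    {u : Fin k → F} (hu : u ≠ 0) (x : Fin k → F) :
    (A.filter fun X => X *ᵥ u = x).card ≤ d := by
  have := finite_submodule (F := F) (V := V)
  have hne : e (u, x) ≠ 0 := by
    intro h
    exact hu (congrArg Prod.fst ((map_eq_zero_iff e e.injective).1 h))
  refine le_trans ?_ (hd (Submodule.span F {e (u, x)}) (finrank_span_singleton hne))
  rw [← Set.ncard_coe_finset]
  refine Set.ncard_le_ncard_of_injOn
    (fun X : Matrix (Fin k) (Fin k) F => X.mulVecLin.graph.map (e : _ →ₗ[F] V)) ?_
    (map_graph_injective e).injOn (Set.toFinite _)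
  intro X hX
  obtain ⟨hXA, hXu⟩ := Finset.mem_filter.1 (Finset.mem_coe.1 hX)
  refine ⟨hA X hXA, ?_⟩
  rw [Submodule.span_singleton_le_iff_mem]
  exact ⟨(u, x), by simp [hXu], rfl⟩

theorem card_filter_vecMul_le (e : ((Fin k → F) × (Fin k → F)) ≃ₗ[F] V)
    {S : Set (Submodule F V)} {A : Finset (Matrix (Fin k) (Fin k) F)}
    (hA : ∀ X ∈ A, X.mulVecLin.graph.map (e : _ →ₗ[F] V) ∈ S) {d : ℕ}
    (hd : ∀ H : Submodule F V, Module.finrank F H + 1 = 2 * k → {W ∈ S | W ≤ H}.ncard ≤ d)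
    {v : Fin k → F} (hv : v ≠ 0) (x : Fin k → F) :
    (A.filter fun X => v ᵥ* X = x).card ≤ d := by
  have := finite_submodule (F := F) (V := V)
  refine le_trans ?_ (hd ((pairHyperplane v x).map (e : _ →ₗ[F] V))
    (by rw [LinearEquiv.finrank_map_eq, finrank_pairHyperplane hv]))
  rw [← Set.ncard_coe_finset]
  refine Set.ncard_le_ncard_of_injOn
    (fun X : Matrix (Fin k) (Fin k) F => X.mulVecLin.graph.map (e : _ →ₗ[F] V)) ?_
    (map_graph_injective e).injOn (Set.toFinite _)
  intro X hX
  obtain ⟨hXA, hXv⟩ := Finset.mem_filter.1 (Finset.mem_coe.1 hX)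
  exact ⟨hA X hXA, Submodule.map_mono (graph_le_pairHyperplane hXv)⟩

end Chart

/-! ### Numerical estimates for the density and the degrees -/

section Numerics

/-- The first terms of Euler's pentagonal series. The extra power q⁻¹ ^ (m + 2) makes the case m = 0
an equality and carries the induction. -/
theorem prod_one_sub_ge {q : ℝ} (hq : 2 ≤ q) (m : ℕ) :
    1 - q⁻¹ - q⁻¹ ^ 2 + q⁻¹ ^ (m + 2) ≤ ∏ i ∈ range (m + 1), (1 - q⁻¹ ^ (i + 1)) := by
  have hp : 0 < q⁻¹ := by positivity
  have hp2 : q⁻¹ ≤ 1 / 2 := by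
    rw [inv_le_comm₀ (by linarith) (by norm_num)]
    linarith
  set p := q⁻¹
  induction m with
  | zero => simp
  | succ m ih =>
    rw [Finset.prod_range_succ]
    have h1 : 0 < p ^ (m + 2) := by positivity
    have h2 : p ^ (m + 2) ≤ p ^ 2 := pow_le_pow_of_le_one hp.le (by linarith) (by omega)
    have h3 : p ^ (m + 1 + 2) = p * p ^ (m + 2) := by ring
    have h4 : p ^ (m + 1 + 1) = p ^ (m + 2) := by ring
    have h5 : p ^ 2 ≤ 1 / 4 := by nlinarith
    rw [h3, h4]
    refine le_trans ?_ (mul_le_mul_of_nonneg_right ih (by linarith))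
    nlinarith

variable {F : Type*} [Field F] [Fintype F]

theorem gaussCoeff_mul_le {k : ℕ} (hk : 1 ≤ k) :
    (gaussCoeff F (2 * k) k : ℝ) *
      (1 - (Fintype.card F : ℝ)⁻¹ - (Fintype.card F : ℝ)⁻¹ ^ 2) ≤
        (Fintype.card F : ℝ) ^ (k ^ 2) := by
  classical
  obtain ⟨m, rfl⟩ : ∃ m, k = m + 1 := ⟨k - 1, by omega⟩
  have hq := two_le_card (F := F)
  have h := gaussCoeff_mul_prod_le (F := F) (2 * (m + 1)) (m + 1)
  have h1 := prod_one_sub_ge hq m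
  set q : ℝ := (Fintype.card F : ℝ) with hqdef
  have hq0 : 0 < q := by linarith
  have h2 : ((∏ i : Fin (m + 1), (Fintype.card F ^ (m + 1) - Fintype.card F ^ (i : ℕ)) : ℕ) : ℝ) =
      q ^ ((m + 1) ^ 2) * ∏ i ∈ range (m + 1), (1 - q⁻¹ ^ (i + 1)) := by
    rw [← Finset.prod_range_reflect, Finset.prod_range, sq, pow_mul, Nat.cast_prod]
    rw [show (q ^ (m + 1)) ^ (m + 1) = ∏ _i : Fin (m + 1), q ^ (m + 1) by simp,
      ← Finset.prod_mul_distrib]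
    refine Finset.prod_congr rfl fun i _ => ?_
    have hi := i.2
    rw [Nat.cast_sub (Nat.pow_le_pow_right Fintype.card_pos hi.le)]
    push_cast
    have h3 : m - (i : ℕ) + 1 = m + 1 - i := by omega
    rw [← hqdef, h3, mul_sub, mul_one, inv_pow, ← pow_sub_mul_pow q hi.le]
    have : q ^ (m + 1 - (i : ℕ)) ≠ 0 := by positivity
    field_simp
  have h3 : (gaussCoeff F (2 * (m + 1)) (m + 1) : ℝ) *
      (q ^ ((m + 1) ^ 2) * ∏ i ∈ range (m + 1), (1 - q⁻¹ ^ (i + 1))) ≤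
        q ^ ((m + 1) ^ 2) * q ^ ((m + 1) ^ 2) := by
    rw [← h2, ← pow_add]
    have h4 : (m + 1) ^ 2 + (m + 1) ^ 2 = 2 * (m + 1) * (m + 1) := by ring
    rw [h4, hqdef]
    exact_mod_cast h
  have h5 : (0 : ℝ) < q ^ ((m + 1) ^ 2) := by positivity
  have h6 : (gaussCoeff F (2 * (m + 1)) (m + 1) : ℝ) *
      ∏ i ∈ range (m + 1), (1 - q⁻¹ ^ (i + 1)) ≤ q ^ ((m + 1) ^ 2) := by
    refine le_of_mul_le_mul_left ?_ h5
    linarith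
  refine le_trans (mul_le_mul_of_nonneg_left ?_ (Nat.cast_nonneg _)) h6
  have : 0 < q⁻¹ ^ (m + 2) := by positivity
  linarith

theorem gaussCoeff_le_mul {k : ℕ} (hk : 2 ≤ k) :
    (gaussCoeff F (2 * k) k : ℝ) * (((Fintype.card F : ℝ) ^ k - 1) *
      ((Fintype.card F : ℝ) ^ k - Fintype.card F)) ≤
    (gaussCoeff F (2 * k - 2) (k - 2) : ℝ) * ((((Fintype.card F : ℝ) ^ k) ^ 2 - 1) *
      (((Fintype.card F : ℝ) ^ k) ^ 2 - Fintype.card F)) := by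
  have h := gaussCoeff_mul_pairs_le (F := F) (2 * k) k hk (by omega)
  have h1 : ∀ n : ℕ, 1 ≤ n →
      ((∏ i : Fin 2, (Fintype.card F ^ n - Fintype.card F ^ (i : ℕ)) : ℕ) : ℝ) =
        ((Fintype.card F : ℝ) ^ n - 1) * ((Fintype.card F : ℝ) ^ n - Fintype.card F) := by
    intro n hn
    rw [Fin.prod_univ_two, Nat.cast_mul,
      Nat.cast_sub (Nat.pow_le_pow_right Fintype.card_pos (by simp)),
      Nat.cast_sub (Nat.pow_le_pow_right Fintype.card_pos (by simpa using hn))]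
    simp
  have h2 : ((gaussCoeff F (2 * k) k * ∏ i : Fin 2,
      (Fintype.card F ^ k - Fintype.card F ^ (i : ℕ)) : ℕ) : ℝ) ≤
      (((∏ i : Fin 2, (Fintype.card F ^ (2 * k) - Fintype.card F ^ (i : ℕ))) *
        gaussCoeff F (2 * k - 2) (k - 2) : ℕ) : ℝ) := by exact_mod_cast h
  rw [Nat.cast_mul, Nat.cast_mul, h1 k (by omega), h1 (2 * k) (by omega), mul_comm 2 k,
    pow_mul] at h2
  rw [mul_comm 2 k]
  linarith

/-- To be used with `n = q ^ (k ^ 2)`, `Q = q ^ k`, the Gaussian coefficients `N = [2k, k]`,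
`g = [k, 1]` and `b = [2k - 2, k - 2]`, the size `y` of the family and the number `a` of the
matrices that represent its members in a chart. -/
theorem density_bound {q Q n N g b y a : ℝ} (hq : 3 ≤ q) (hQ : q ^ 5 ≤ Q)
    (hn : 0 < n) (hN : 0 < N) (hb : 0 ≤ b)
    (hg : Q - 1 ≤ g * (q - 1)) (hbN : N * ((Q - 1) * (Q - q)) ≤ b * ((Q ^ 2 - 1) * (Q ^ 2 - q)))
    (hy : (1 + 3 * q⁻¹) * g * b ≤ y) (ha : n * y ≤ a * N) :
    (q + 5 / 2) * n ≤ a * (Q - 1) * (q * (q - 1)) := by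
  have hq0 : 0 < q := by linarith
  have hQ81 : 81 * q ≤ Q := by nlinarith [pow_le_pow_left₀ (by norm_num) hq 4]
  have hy' : (q + 3) * g * b ≤ q * y := by
    have : q * ((1 + 3 * q⁻¹) * g * b) = (q + 3) * g * b := by field_simp
    rw [← this]
    exact mul_le_mul_of_nonneg_left hy hq0.le
  have hc : 0 < (Q ^ 2 - 1) * (Q ^ 2 - q) := by
    apply mul_pos <;> nlinarith
  -- Passing from q + 3 to q + 5/2 pays for replacing the exact ratios of Gaussian coefficients by
  -- powers of Q. This is affordable because Q ≥ q^5.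
  have key : (q + 5 / 2) * ((Q ^ 2 - 1) * (Q ^ 2 - q)) ≤
      (q + 3) * (Q - 1) * ((Q - 1) * ((Q - 1) * (Q - q))) := by
    have hQ27 : 27 * q ^ 2 ≤ Q := by nlinarith [pow_le_pow_left₀ (by norm_num) hq 3, sq_nonneg q]
    have h0 : q ^ 2 + 6 * q + 17 / 2 ≤ Q / 2 := by nlinarith
    have h1 : (q ^ 2 + 6 * q + 17 / 2) * Q ^ 2 ≤ Q / 2 * Q ^ 2 := by gcongr
    have h2 : (q + 5 / 2) * ((Q + 1) * (Q ^ 2 - q)) ≤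
        (q + 3) * ((Q - 1) * ((Q - 1) * (Q - q))) := by
      nlinarith [mul_pos hq0 (by linarith : 0 < Q), mul_pos (mul_pos hq0 hq0) (by linarith : 0 < Q)]
    have h3 := mul_le_mul_of_nonneg_left h2 (by linarith : 0 ≤ Q - 1)
    linarith
  have h1 : (q + 3) * (Q - 1) * b ≤ q * (q - 1) * y := by
    calc (q + 3) * (Q - 1) * b ≤ (q + 3) * (g * (q - 1)) * b := by gcongr
      _ = (q - 1) * ((q + 3) * g * b) := by ring
      _ ≤ (q - 1) * (q * y) := mul_le_mul_of_nonneg_left hy' (by linarith)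
      _ = q * (q - 1) * y := by ring
  refine le_of_mul_le_mul_right ?_ (mul_pos hN hc)
  have hQ1 : 0 ≤ Q - 1 := by linarith
  calc (q + 5 / 2) * n * (N * ((Q ^ 2 - 1) * (Q ^ 2 - q)))
      = n * N * ((q + 5 / 2) * ((Q ^ 2 - 1) * (Q ^ 2 - q))) := by ring
    _ ≤ n * N * ((q + 3) * (Q - 1) * ((Q - 1) * ((Q - 1) * (Q - q)))) := by gcongr
    _ = n * (q + 3) * (Q - 1) ^ 2 * (N * ((Q - 1) * (Q - q))) := by ring
    _ ≤ n * (q + 3) * (Q - 1) ^ 2 * (b * ((Q ^ 2 - 1) * (Q ^ 2 - q))) := by gcongr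
    _ = n * ((Q ^ 2 - 1) * (Q ^ 2 - q)) * (Q - 1) * ((q + 3) * (Q - 1) * b) := by ring
    _ ≤ n * ((Q ^ 2 - 1) * (Q ^ 2 - q)) * (Q - 1) * (q * (q - 1) * y) := by gcongr
    _ = ((Q ^ 2 - 1) * (Q ^ 2 - q)) * (Q - 1) * (q * (q - 1)) * (n * y) := by ring
    _ ≤ ((Q ^ 2 - 1) * (Q ^ 2 - q)) * (Q - 1) * (q * (q - 1)) * (a * N) := by
        apply mul_le_mul_of_nonneg_left ha
        apply mul_nonneg (mul_nonneg hc.le hQ1)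
        exact mul_nonneg hq0.le (by linarith)
    _ = _ := by ring

/-- The chart density is at least (1 - p - p^2)(1 + 3p) ≥ 1 + p/3 times that of B, where p = 1/q.
The last inequality is an equality at q = 3, and 1 / (1 + p/3) is the share 3q / (3q + 1). -/
theorem degree_bound {q n N B y a d : ℝ} (hq : 3 ≤ q) (hn : 0 < n) (hB : 0 ≤ B)
    (ha0 : 0 ≤ a) (hN : N * (1 - q⁻¹ - q⁻¹ ^ 2) ≤ n) (hy : (1 + 3 * q⁻¹) * B ≤ y)
    (ha : n * y ≤ a * N) (hd : d ≤ B) : d * (3 * q + 1) ≤ a * (3 * q) := by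
  have hq0 : 0 < q := by linarith
  have hp : 0 < q⁻¹ := by positivity
  have hp3 : q⁻¹ ≤ 1 / 3 := by
    rw [inv_le_comm₀ hq0 (by norm_num)]
    linarith
  have hqp : q * q⁻¹ = 1 := mul_inv_cancel₀ hq0.ne'
  set p := q⁻¹
  have hc : 0 < 1 - p - p ^ 2 := by nlinarith
  have h1 : 1 + p / 3 ≤ (1 - p - p ^ 2) * (1 + 3 * p) := by nlinarith
  have h2 : n * ((1 - p - p ^ 2) * y) ≤ n * a := by
    calc n * ((1 - p - p ^ 2) * y) = (1 - p - p ^ 2) * (n * y) := by ring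
      _ ≤ (1 - p - p ^ 2) * (a * N) := mul_le_mul_of_nonneg_left ha hc.le
      _ = a * (N * (1 - p - p ^ 2)) := by ring
      _ ≤ a * n := mul_le_mul_of_nonneg_left hN ha0
      _ = n * a := by ring
  have h3 : (1 - p - p ^ 2) * y ≤ a := le_of_mul_le_mul_left h2 hn
  have h4 : (1 + p / 3) * B ≤ a := by
    refine le_trans ?_ ((mul_le_mul_of_nonneg_left hy hc.le).trans h3)
    nlinarith
  have h5 : B * (3 * q + 1) = 3 * q * ((1 + p / 3) * B) := by
    linear_combination (-B) * hqp
  calc d * (3 * q + 1) ≤ B * (3 * q + 1) := by gcongr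
    _ = 3 * q * ((1 + p / 3) * B) := h5
    _ ≤ 3 * q * a := by gcongr
    _ = a * (3 * q) := by ring

end Numerics

end QKneser

/-! ### The main theorem -/

theorem theorem5 {F : Type*} [Field F] [Fintype F] (q k : ℕ) (hF : Fintype.card F = q)
    (hq : 3 ≤ q) (hk : 5 ≤ k) (Y : Set (KSpace F (2 * k) k))
    (hY : (qKneser F (2 * k) k).IsIndepSet Y)
    (hdict : ¬ ∃ D : Set (KSpace F (2 * k) k), IsDictator D ∧ Y ⊆ D)
    (hdual : ¬ ∃ D : Set (KSpace F (2 * k) k), IsDualDictator D ∧ Y ⊆ D) :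
    (Y.ncard : ℝ) <
      (1 + 3 * (q : ℝ)⁻¹) * (gaussCoeff F k 1 : ℝ) * (gaussCoeff F (2 * k - 2) (k - 2) : ℝ) := by
  classical
  subst hF
  by_contra! hlarge
  set S : Set (Submodule F (Fin (2 * k) → F)) := Subtype.val '' Y with hSdef
  have hScard : S.ncard = Y.ncard := Set.ncard_image_of_injective _ Subtype.val_injective
  have hSk : ∀ W ∈ S, Module.finrank F W = k := by
    rintro _ ⟨W, -, rfl⟩
    exact W.2
  have hSint : ∀ W ∈ S, ∀ W' ∈ S, W ⊓ W' ≠ ⊥ := by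
    rintro _ ⟨W, hW, rfl⟩ _ ⟨W', hW', rfl⟩ h0
    by_cases h : W = W'
    · subst h
      rw [inf_idem, ← Submodule.finrank_eq_zero (R := F), W.2] at h0
      omega
    · exact hY hW hW' h ⟨h, h0⟩
  have hV : Module.finrank F (Fin (2 * k) → F) = 2 * k := by simp
  have hpoint : ∀ P : Submodule F (Fin (2 * k) → F), Module.finrank F P = 1 →
      {W ∈ S | P ≤ W}.ncard ≤ gaussCoeff F k 1 * gaussCoeff F (2 * k - 2) (k - 2) := by
    intro P hP
    have hex : ∃ W ∈ Y, ¬ P ≤ W.1 := by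
      by_contra! h
      exact hdict ⟨_, ⟨P, hP, rfl⟩, h⟩
    obtain ⟨W, hW, hPW⟩ := hex
    have := QKneser.ncard_point_le hSk hSint hP ⟨W, hW, rfl⟩ hPW
    rwa [hV] at this
  have hhyper : ∀ H : Submodule F (Fin (2 * k) → F), Module.finrank F H + 1 = 2 * k →
      {W ∈ S | W ≤ H}.ncard ≤ gaussCoeff F k 1 * gaussCoeff F (2 * k - 2) (k - 2) := by
    intro H hH
    have hex : ∃ W ∈ Y, ¬ W.1 ≤ H := by
      by_contra! h
      exact hdual ⟨_, ⟨H, hH, rfl⟩, h⟩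
    obtain ⟨W, hW, hWH⟩ := hex
    have := QKneser.ncard_hyperplane_le (by omega) hV hSk hSint hH ⟨W, hW, rfl⟩ hWH
    rwa [hV] at this
  have e₀ : ((Fin k → F) × (Fin k → F)) ≃ₗ[F] (Fin (2 * k) → F) :=
    LinearEquiv.ofFinrankEq _ _ (by simp; omega)
  -- The spaces being averaged are the graphs of all q^(k^2) matrices in a fixed chart e₀. The chart
  -- e = e₀ followed by g catches at least the average share of Y.
  obtain ⟨g, hg⟩ := QKneser.exists_linearEquiv_average S hSk
    (fun X : Matrix (Fin k) (Fin k) F => X.mulVecLin.graph.map (e₀ : _ →ₗ[F] (Fin (2 * k) → F)))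
    (fun X => by rw [LinearEquiv.finrank_map_eq, QKneser.finrank_graph])
  set e := e₀.trans g
  have he : ∀ X : Matrix (Fin k) (Fin k) F,
      (X.mulVecLin.graph.map (e₀ : _ →ₗ[F] (Fin (2 * k) → F))).map
        (g : (Fin (2 * k) → F) →ₗ[F] (Fin (2 * k) → F)) =
      X.mulVecLin.graph.map (e : _ →ₗ[F] (Fin (2 * k) → F)) := by
    intro X
    rw [LinearEquiv.coe_trans, Submodule.map_comp]
  simp_rw [he] at hg
  set A : Finset (Matrix (Fin k) (Fin k) F) :=
    Finset.univ.filter fun X => X.mulVecLin.graph.map (e : _ →ₗ[F] (Fin (2 * k) → F)) ∈ S with hAdef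
  have hA : ∀ X ∈ A, X.mulVecLin.graph.map (e : _ →ₗ[F] (Fin (2 * k) → F)) ∈ S := by
    intro X hX
    simpa [hAdef] using hX
  have hcard : (Fintype.card F : ℝ) ^ (k ^ 2) * Y.ncard ≤ A.card * gaussCoeff F (2 * k) k := by
    rw [hV, hScard, Nat.card_eq_fintype_card, Fintype.card_subtype, ← hAdef,
      QKneser.card_matrix_sq] at hg
    exact_mod_cast hg
  have hq' : (3 : ℝ) ≤ Fintype.card F := by exact_mod_cast hq
  have hn : (0 : ℝ) < (Fintype.card F : ℝ) ^ (k ^ 2) := by positivity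
  have hN : (0 : ℝ) < gaussCoeff F (2 * k) k := by
    have := QKneser.finite_submodule (F := F) (V := Fin (2 * k) → F)
    have : Nonempty (KSpace F (2 * k) k) :=
      ⟨⟨(0 : Matrix (Fin k) (Fin k) F).mulVecLin.graph.map (e₀ : _ →ₗ[F] (Fin (2 * k) → F)),
        by rw [LinearEquiv.finrank_map_eq, QKneser.finrank_graph]⟩⟩
    exact_mod_cast (Nat.card_pos : 0 < Nat.card (KSpace F (2 * k) k))
  have hdeg : ∀ d : ℕ, d ≤ gaussCoeff F k 1 * gaussCoeff F (2 * k - 2) (k - 2) →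
      (d : ℝ) * (3 * Fintype.card F + 1) ≤ A.card * (3 * Fintype.card F) := by
    intro d hd
    refine QKneser.degree_bound (B := (gaussCoeff F k 1 : ℝ) * gaussCoeff F (2 * k - 2) (k - 2))
      hq' hn (by positivity) (by positivity) (QKneser.gaussCoeff_mul_le (by omega)) ?_ hcard ?_
    · rw [← mul_assoc]
      exact hlarge
    · exact_mod_cast hd
  refine QKneser.false_of_singular_differences hk hq A ?_ ?_ ?_ ?_
  · intro X hX X' hX'
    exact QKneser.det_sub_eq_zero e (hSint _ (hA X hX) _ (hA X' hX'))
  · refine QKneser.density_bound hq' (pow_le_pow_right₀ (by linarith) hk) hn hN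
      (Nat.cast_nonneg _) (QKneser.card_sub_one_le_gaussCoeff_one k)
      (QKneser.gaussCoeff_le_mul (by omega)) hlarge hcard
  · intro u x hu
    exact hdeg _ (QKneser.card_filter_mulVec_le e hA hpoint hu x)
  · intro u x hu
    exact hdeg _ (QKneser.card_filter_vecMul_le e hA hhyper hu x)
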